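/- Throughout $e(x)=e^{2\pi i x}$, $\mathbb H$ is the upper half-plane, and $\gamma=\begin{pmatrix}a&b\\c&d\end{pmatrix}\in SL_2(\mathbb Z)$ acts by $\gamma\tau=\frac{a\tau+b}{c\tau+d}$. **Theta functions.** For a positive integer $m$ and an integer $0\le r<2m$ put, for $\tau\in\mathbb H$, $z\in\mathbb C$, $$\theta^J_{m,r}(\tau,z)=\sum_{n\in\mathbb Z}e\Big(m\big((n+\tfrac r{2m})^2\tau+2(n+\tfrac r{2m})z\big)\Big),\qquad \theta_{m,r}(\tau)=\theta^J_{m,r}(\tau,0).$$ For $\gamma\in SL_2(\mathbb Z)$ let $U_1(\gamma)\in M_2(\mathbb C)$ be the unique matrix with $$\begin{pmatrix}\theta^J_{1,0}\\ \theta^J_{1,1}\end{pmatrix}\Big(\gamma\tau,\frac z{c\tau+d}\Big)=e\Big(\frac{cz^2}{c\tau+d}\Big)(c\tau+d)^{1/2}\,U_1(\gamma)\begin{pmatrix}\theta^J_{1,0}\\ \theta^J_{1,1}\end{pmatrix}(\tau,z)$$ for all $\tau,z$ (principal square root). For $\gamma\in\Gamma_0(m)$ put $\gamma_m=\begin{pmatrix}a&bm\\c/m&d\end{pmatrix}$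 and $\omega_m(\gamma)=\det U_1(\gamma_m)$; this is a character of $\Gamma_0(m)$. **Spaces.** For an integer $k$, a positive integer $M$ and a character $v$ of $\Gamma_0(M)$, $M_k(\Gamma_0(M),v)$ is the space of holomorphic $f:\mathbb H\to\mathbb C$ with $f(\gamma\tau)=v(\gamma)(c\tau+d)^kf(\tau)$ for $\gamma\in\Gamma_0(M)$ such that $(c\tau+d)^{-k}f(g\tau)$ is bounded as $\operatorname{Im}\tau\to\infty$ for every $g=\begin{pmatrix}*&*\\c&d\end{pmatrix}\in SL_2(\mathbb Z)$. For a Dirichlet character $\chi$ modulo $M$, $J_{k,m}(\Gamma_0(M),\chi)$ is the space of holomorphic $\phi:\mathbb H\times\mathbb C\to\mathbb C$ with $$\phi\Big(\gamma\tau,\frac z{c\tau+d}\Big)=\chi(d)(c\tau+d)^ke\Big(\frac{mcz^2}{c\tau+d}\Big)\phi(\tau,z)\quad(\gamma\in\Gamma_0(M)),$$ $$\phi(\tau,z+\lambda\tau+\mu)=e\big(-m(\lambda^2\tau+2\lambda z)\big)\phi(\tau,z)\quad(\lambda,\mu\in\mathbb Z),$$ such that for every $g=\begin{pmatrix}*&*\\c&d\end{pmatrix}\in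 SL_2(\mathbb Z)$ the function $(c\tau+d)^{-k}e\big(-\frac{mcz^2}{c\tau+d}\big)\phi\big(g\tau,\frac z{c\tau+d}\big)$ has an absolutely convergent Fourier expansion $\sum_{n,r} c(n,r)e(n\tau+rz)$ with $r\in\mathbb Z$, $n\in\mathbb Q$ of bounded denominator, and $c(n,r)=0$ unless $n\ge r^2/4m$. Every $\phi\in J_{k,m}(\Gamma_0(M),\chi)$ has a unique theta decomposition $\phi(\tau,z)=\sum_{r=0}^{2m-1}h_{m,r}(\tau)\theta^J_{m,r}(\tau,z)$. Let $J^*_{k,m}(\Gamma_0(M),\chi)$ be the subspace of those $\phi$ with $h_{m,r}=0$ for all $r\ne 0,m$, and let $J^*_{k,m}(\Gamma_0(M),\chi)^0$ be the subspace of those $\phi\in J^*_{k,m}(\Gamma_0(M),\chi)$ for which $D_0\phi:=\phi(\tau,0)$ vanishes identically. **Theorem.** Let $k,m,N$ be positive integers with $m$ square-free, and let $\chi$ be a Dirichlet character modulo $mN$. Then $\theta_{m,0}$ and $\theta_{m,m}$ have no zeros in $\mathbb H$, and there is a $\mathbb C$-linear isomorphism $$\Lambda_m^*: J^*_{k,m}(\Gamma_0(mN),\chi)^0\longrightarrow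 M_{k-1}(\Gamma_0(mN),\chi\,\overline{\omega}_m),\qquad \phi\longmapsto\varphi=\frac{h_{m,0}}{\theta_{m,m}}=\frac{-h_{m,m}}{\theta_{m,0}},$$ where $\chi\,\overline\omega_m$ is the character $\gamma\mapsto\chi(d)\overline{\omega_m(\gamma)}$ of $\Gamma_0(mN)$. Its inverse sends $\varphi$ to $$\phi(\tau,z)=\varphi(\tau)\big(\theta_{m,m}(\tau)\theta^J_{m,0}(\tau,z)-\theta_{m,0}(\tau)\theta^J_{m,m}(\tau,z)\big).$$ -/

import Mathlib

open Complex ModularGroup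
open UpperHalfPlane hiding I
open scoped MatrixGroups Real Manifold ComplexConjugate ModularForm

namespace JacobiTheta

noncomputable section

/-- The Jacobi theta function `θ^J_{m,r}(τ,z) = ∑_{n ∈ ℤ} e(m((n + r/2m)² τ + 2 (n + r/2m) z))`,
where `e(x) = exp(2πix)`. -/
def thetaJ (m r : ℕ) (τ : ℍ) (z : ℂ) : ℂ :=
  ∑' n : ℤ, cexp (2 * π * I * m *
    (((n : ℂ) + r / (2 * m)) ^ 2 * τ + 2 * ((n : ℂ) + r / (2 * m)) * z))

/-- The theta constant `θ_{m,r}(τ) = θ^J_{m,r}(τ,0)`. -/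
def theta (m r : ℕ) (τ : ℍ) : ℂ := thetaJ m r τ 0

/-! ### The index one theta representation -/

/-- `U` describes how the column vector `(θ^J_{1,0}, θ^J_{1,1})` transforms under `γ = (a b; c d)`:
`Θ^J(γ(τ,z)) = e(c z² / (cτ + d)) (cτ + d)^{1/2} U Θ^J(τ,z)`, with the principal square root.
Here `denom γ τ = cτ + d`. -/
def IsThetaMatrix (γ : SL(2, ℤ)) (U : Matrix (Fin 2) (Fin 2) ℂ) : Prop :=
  ∀ (τ : ℍ) (z : ℂ) (i : Fin 2),
    thetaJ 1 i (γ • τ) (z / denom γ τ) =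
      cexp (2 * π * I * ((γ 1 0 : ℤ) * z ^ 2 / denom γ τ)) * denom γ τ ^ (1 / 2 : ℂ) *
        (U.mulVec fun j : Fin 2 => thetaJ 1 j τ z) i

lemma thetaJ_one_eq (r : ℕ) (τ : ℍ) (z : ℂ) :
    thetaJ 1 r τ z = cexp (2 * π * I * (r ^ 2 / 4 * τ + r * z)) *
      jacobiTheta₂ (r * τ + 2 * z) (2 * τ) := by
  unfold thetaJ jacobiTheta₂ jacobiTheta₂_term
  rw [← tsum_mul_left]
  congr 1; ext n
  rw [← Complex.exp_add]
  congr 1; push_cast; ring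

lemma hasSum_thetaJ_one (r : ℕ) (τ : ℍ) (z : ℂ) :
    HasSum (fun n : ℤ => cexp (2 * π * I * (((n : ℂ) + r / 2) ^ 2 * τ + 2 * ((n : ℂ) + r / 2) * z)))
      (thetaJ 1 r τ z) := by
  rw [thetaJ_one_eq]
  have h2 : 0 < (2 * (τ : ℂ)).im := by
    have := τ.im_pos
    simpa using this
  have h := (hasSum_jacobiTheta₂_term (r * τ + 2 * z) h2).mul_left
    (cexp (2 * π * I * (r ^ 2 / 4 * τ + r * z)))
  have e : (fun n : ℤ => cexp (2 * π * I * (((n : ℂ) + r / 2) ^ 2 * τ + 2 * ((n : ℂ) + r / 2) * z)))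
      = fun n : ℤ => cexp (2 * π * I * (r ^ 2 / 4 * τ + r * z)) *
        jacobiTheta₂_term n (r * τ + 2 * z) (2 * τ) := by
    funext n
    unfold jacobiTheta₂_term
    rw [← Complex.exp_add]
    congr 1; ring
  rw [e]
  exact h

lemma thetaJ_split (τ : ℍ) (z : ℂ) :
    jacobiTheta₂ z (τ / 2) = thetaJ 1 0 τ z + thetaJ 1 1 τ z := by
  have h2 : 0 < ((τ : ℂ) / 2).im := by
    have := τ.im_pos
    have h : ((τ : ℂ) / 2).im = τ.im / 2 := by
      rw [show (2 : ℂ) = ((2 : ℝ) : ℂ) by norm_num, Complex.div_ofReal_im]; rfl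
    rw [h]; positivity
  refine (hasSum_jacobiTheta₂_term z h2).unique ?_
  have h0 := hasSum_thetaJ_one 0 τ z
  have h1 := hasSum_thetaJ_one 1 τ z
  have hinj : Function.Injective (fun k : ℤ => 2 * k) := fun a b h => by simpa using h
  have hinj' : Function.Injective (fun k : ℤ => 2 * k + 1) := fun a b h => by simpa using h
  have e0 : HasSum ((fun n : ℤ => jacobiTheta₂_term n z (τ / 2)) ∘ fun k : ℤ => 2 * k)
      (thetaJ 1 0 τ z) := by
    convert h0 using 2 with n
    simp only [Function.comp, jacobiTheta₂_term]
    congr 1; push_cast; ring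
  have e1 : HasSum ((fun n : ℤ => jacobiTheta₂_term n z (τ / 2)) ∘ fun k : ℤ => 2 * k + 1)
      (thetaJ 1 1 τ z) := by
    convert h1 using 2 with n
    simp only [Function.comp, jacobiTheta₂_term]
    congr 1; push_cast; ring
  refine HasSum.add_isCompl ?_ (hinj.hasSum_range_iff.mpr e0) (hinj'.hasSum_range_iff.mpr e1)
  have r0 : (Set.range fun k : ℤ => 2 * k) = {n : ℤ | Even n} := Set.ext fun n =>
    ⟨fun ⟨k, hk⟩ => ⟨k, by simp only at hk; omega⟩, fun ⟨k, hk⟩ => ⟨k, by simp only; omega⟩⟩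
  have r1 : (Set.range fun k : ℤ => 2 * k + 1) = {n : ℤ | Odd n} := Set.ext fun n =>
    ⟨fun ⟨k, hk⟩ => ⟨k, hk.symm⟩, fun ⟨k, hk⟩ => ⟨k, hk.symm⟩⟩
  rw [r0, r1]
  exact Int.isCompl_even_odd

lemma thetaJ_one_sub_half (r : ℕ) (τ : ℍ) (z : ℂ) :
    thetaJ 1 r τ (z - 1 / 2) = (-1) ^ r * thetaJ 1 r τ z := by
  unfold thetaJ
  rw [← tsum_mul_left]
  congr 1; ext n
  have : ((-1 : ℂ)) ^ r = cexp (-(n * (2 * π * I)) - r * (π * I)) := by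
    rw [Complex.exp_sub, Complex.exp_nat_mul (π * I) r, Complex.exp_pi_mul_I]
    rw [show -((n : ℂ) * (2 * π * I)) = ((-n : ℤ) : ℂ) * (2 * π * I) by push_cast; ring,
      Complex.exp_int_mul_two_pi_mul_I, one_div, ← inv_pow]
    norm_num
  rw [this, ← Complex.exp_add]
  congr 1; push_cast; ring

/-- Two square roots of one function on the upper half-plane agree up to a constant sign -/
lemma exists_sign {f g : ℍ → ℂ} (hf : Continuous f) (hg : Continuous g)
    (h : ∀ τ, f τ ^ 2 = g τ ^ 2) (hne : ∀ τ, g τ ≠ 0) :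
    ∃ ε : ℂ, ε ^ 2 = 1 ∧ ∀ τ, f τ = ε * g τ := by
  rcases (isPreconnected_univ (α := ℍ)).eq_or_eq_neg_of_sq_eq hf.continuousOn hg.continuousOn
    (fun τ _ => h τ) (fun {τ} _ => hne τ) with h | h
  · exact ⟨1, by norm_num, fun τ => by simpa using h (Set.mem_univ τ)⟩
  · exact ⟨-1, by norm_num, fun τ => by simpa using h (Set.mem_univ τ)⟩

lemma sqrt_sq (w : ℂ) : (w ^ (1 / 2 : ℂ)) ^ 2 = w := by
  rw [← Complex.cpow_nat_mul]; norm_num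

lemma sqrt_ne_zero {w : ℂ} (hw : w ≠ 0) : w ^ (1 / 2 : ℂ) ≠ 0 := by
  intro h
  have := sqrt_sq w
  rw [h] at this; exact hw (by simpa using this.symm)

lemma continuous_sqrt_denom (γ : SL(2, ℤ)) :
    Continuous fun τ : ℍ => denom γ τ ^ (1 / 2 : ℂ) := by
  simp only [ModularGroup.denom_apply]
  by_cases hc : γ 1 0 = 0
  · simp only [hc]; simpa using continuous_const
  · refine Continuous.cpow (by fun_prop) continuous_const fun τ => ?_
    right
    have : ((γ 1 0 : ℂ) * (τ : ℂ) + (γ 1 1 : ℂ)).im = γ 1 0 * τ.im := by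
      simp
    rw [this]
    exact mul_ne_zero (by exact_mod_cast hc) τ.im_ne_zero

lemma denom_mul (γ γ' : SL(2, ℤ)) (τ : ℍ) :
    denom ((γ * γ' : SL(2, ℤ)) : GL (Fin 2) ℝ) τ = denom γ (γ' • τ : ℍ) * denom γ' τ := by
  have := denom_cocycle_σ (γ : GL (Fin 2) ℝ) (γ' : GL (Fin 2) ℝ) τ
  simpa [σ] using this

lemma cocycle_exp (γ γ' : SL(2, ℤ)) (τ : ℍ) (z : ℂ) :
    ((γ * γ') 1 0 : ℤ) * z ^ 2 / denom ((γ * γ' : SL(2, ℤ)) : GL (Fin 2) ℝ) τ =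
      (γ 1 0 : ℤ) * (z / denom γ' τ) ^ 2 / denom γ (γ' • τ : ℍ) +
        (γ' 1 0 : ℤ) * z ^ 2 / denom γ' τ := by
  have h1 : denom (γ : GL (Fin 2) ℝ) (γ' • τ : ℍ) ≠ 0 := denom_ne_zero _ _
  have h2 : denom (γ' : GL (Fin 2) ℝ) τ ≠ 0 := denom_ne_zero _ _
  have hd : (γ' 0 0 : ℂ) * γ' 1 1 - γ' 0 1 * γ' 1 0 = 1 := by
    have := γ'.det_coe
    rw [Matrix.det_fin_two] at this
    exact_mod_cast this
  have hc : ((γ * γ') 1 0 : ℤ) = γ 1 0 * γ' 0 0 + γ 1 1 * γ' 1 0 := by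
    simp [Matrix.mul_apply, Fin.sum_univ_two]
  have h3 : denom (γ : GL (Fin 2) ℝ) (γ' • τ : ℍ) * denom (γ' : GL (Fin 2) ℝ) τ =
      (γ 1 0 : ℂ) * (γ' 0 0 * τ + γ' 0 1) + γ 1 1 * (γ' 1 0 * τ + γ' 1 1) := by
    rw [ModularGroup.denom_apply] at h2
    rw [ModularGroup.denom_apply, ModularGroup.denom_apply, coe_specialLinearGroup_apply]
    simp only [algebraMap_int_eq, eq_intCast, ofReal_intCast]
    rw [add_mul, mul_assoc, div_mul_cancel₀ _ h2]
  have h4 : denom (γ' : GL (Fin 2) ℝ) τ = (γ' 1 0 : ℂ) * τ + γ' 1 1 := ModularGroup.denom_apply _ _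
  rw [denom_mul, hc]
  push_cast
  field_simp
  linear_combination z ^ 2 * (γ 1 0 : ℂ) * hd - z ^ 2 * (γ' 1 0 : ℂ) * h3 +
    z ^ 2 * ((γ 1 0 : ℂ) * γ' 0 0 + γ 1 1 * γ' 1 0) * h4

lemma IsThetaMatrix.mul {γ γ' : SL(2, ℤ)} {U U' : Matrix (Fin 2) (Fin 2) ℂ}
    (h : IsThetaMatrix γ U) (h' : IsThetaMatrix γ' U') :
    ∃ ε : ℂ, ε ^ 2 = 1 ∧ IsThetaMatrix (γ * γ') (ε • (U * U')) := by
  obtain ⟨ε, hε, hs⟩ := exists_sign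
    (f := fun τ : ℍ => denom γ (γ' • τ : ℍ) ^ (1 / 2 : ℂ) * denom γ' τ ^ (1 / 2 : ℂ))
    (g := fun τ : ℍ => denom ((γ * γ' : SL(2, ℤ)) : GL (Fin 2) ℝ) τ ^ (1 / 2 : ℂ))
    (((continuous_sqrt_denom γ).comp (continuous_const_smul (γ' : GL (Fin 2) ℝ))).mul (continuous_sqrt_denom γ'))
    (continuous_sqrt_denom _)
    (fun τ => by simp only [mul_pow, sqrt_sq, denom_mul])
    (fun τ => sqrt_ne_zero (denom_ne_zero _ _))
  refine ⟨ε, hε, fun τ z i => ?_⟩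
  have hz : z / denom ((γ * γ' : SL(2, ℤ)) : GL (Fin 2) ℝ) τ =
      z / denom γ' τ / denom γ (γ' • τ : ℍ) := by
    rw [denom_mul, div_div, mul_comm]
  have hv : (fun j : Fin 2 => thetaJ 1 j (γ' • τ) (z / denom γ' τ)) =
      (cexp (2 * π * I * ((γ' 1 0 : ℤ) * z ^ 2 / denom γ' τ)) * denom γ' τ ^ (1 / 2 : ℂ)) •
        (U'.mulVec fun j : Fin 2 => thetaJ 1 j τ z) := by
    ext j; rw [h' τ z j]; rfl
  rw [mul_smul, hz, h (γ' • τ) (z / denom γ' τ) i, hv, Matrix.mulVec_smul, Matrix.mulVec_mulVec,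
    Matrix.smul_mulVec, cocycle_exp, mul_add, Complex.exp_add]
  simp only [Pi.smul_apply, smul_eq_mul]
  have := hs τ
  linear_combination (cexp (2 * π * I * ((γ 1 0 : ℤ) * (z / denom γ' τ) ^ 2 / denom γ (γ' • τ : ℍ))) *
    cexp (2 * π * I * ((γ' 1 0 : ℤ) * z ^ 2 / denom γ' τ)) *
    ((U * U').mulVec fun j : Fin 2 => thetaJ 1 j τ z) i) * this

lemma exists_thetaMatrix_T : ∃ U, IsThetaMatrix T U := by
  refine ⟨Matrix.diagonal fun i : Fin 2 => cexp (2 * π * I * (i : ℕ) ^ 2 / 4), fun τ z i => ?_⟩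
  have hd : denom (T : GL (Fin 2) ℝ) τ = 1 := by rw [ModularGroup.denom_apply]; simp [T]
  have h0 : T 1 0 = 0 := by simp [T]
  rw [hd, h0, Matrix.mulVec_diagonal]
  simp only [Int.cast_zero, zero_mul, mul_zero, Complex.exp_zero, Complex.one_cpow,
    one_mul, div_one]
  unfold thetaJ
  rw [← tsum_mul_left]
  congr 1; ext n
  have hn : cexp (2 * π * I * ((n : ℂ) ^ 2 + n * (i : ℕ))) = 1 := by
    rw [mul_comm, show ((n : ℂ) ^ 2 + n * (i : ℕ)) = ((n ^ 2 + n * (i : ℕ) : ℤ) : ℂ) by push_cast; ring,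
      Complex.exp_int_mul_two_pi_mul_I]
  rw [modular_T_smul, coe_vadd, ← one_mul (cexp (_ / 4)), ← hn, ← Complex.exp_add, ← Complex.exp_add]
  congr 1; push_cast; ring

lemma thetaJ_S (τ : ℍ) (z : ℂ) :
    jacobiTheta₂ (2 * z / τ) (-2 / τ) =
      (-I * (τ / 2)) ^ (1 / 2 : ℂ) * cexp (2 * π * I * (z ^ 2 / τ)) *
        (thetaJ 1 0 τ z + thetaJ 1 1 τ z) := by
  have hτ : (τ : ℂ) ≠ 0 := τ.ne_zero
  have hs : (-I * ((τ : ℂ) / 2)) ^ (1 / 2 : ℂ) ≠ 0 := sqrt_ne_zero (by simp [hτ])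
  rw [← thetaJ_split, jacobiTheta₂_functional_equation z (τ / 2)]
  rw [show z / ((τ : ℂ) / 2) = 2 * z / τ by field_simp,
    show -1 / ((τ : ℂ) / 2) = -2 / τ by field_simp,
    show -π * I * z ^ 2 / ((τ : ℂ) / 2) = -(2 * π * I * (z ^ 2 / τ)) by field_simp, Complex.exp_neg]
  have := Complex.exp_ne_zero (2 * π * I * (z ^ 2 / τ))
  field_simp

lemma exists_thetaMatrix_S : ∃ U, IsThetaMatrix S U := by
  obtain ⟨ε, -, hs⟩ := exists_sign
    (f := fun τ : ℍ => (-I * ((τ : ℂ) / 2)) ^ (1 / 2 : ℂ))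
    (g := fun τ : ℍ => (-I / 2) ^ (1 / 2 : ℂ) * denom S τ ^ (1 / 2 : ℂ))
    (by
      refine Continuous.cpow (by fun_prop) continuous_const fun τ => ?_
      left
      have h := τ.im_pos
      simpa using h)
    (continuous_const.mul (continuous_sqrt_denom _))
    (fun τ => by simp only [mul_pow, sqrt_sq, denom_S]; ring)
    (fun τ => mul_ne_zero (sqrt_ne_zero (by simp)) (sqrt_ne_zero (denom_ne_zero _ _)))
  refine ⟨(ε * (-I / 2) ^ (1 / 2 : ℂ)) • !![1, 1; 1, -1], fun τ z i => ?_⟩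
  have hτ : (τ : ℂ) ≠ 0 := τ.ne_zero
  have hs' := hs τ
  simp only [denom_S] at hs'
  have h1 : S 1 0 = 1 := by simp [S]
  have hS : ((S • τ : ℍ) : ℂ) = -1 / τ := by rw [modular_S_smul]; simp [neg_div, inv_neg]
  rw [thetaJ_one_eq, denom_S, h1, hS, Matrix.smul_mulVec]
  fin_cases i
  · have := thetaJ_S τ z
    simp only [Fin.zero_eta, Fin.val_zero, Fin.isValue, Nat.cast_zero, zero_mul, zero_add, ne_eq, OfNat.ofNat_ne_zero, not_false_eq_true, zero_pow, zero_div, mul_zero, Complex.exp_zero, one_mul,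
      Pi.smul_apply, smul_eq_mul, Matrix.mulVec, dotProduct, Fin.sum_univ_two, Int.cast_one]
    rw [show 2 * (z / (τ : ℂ)) = 2 * z / τ by ring, show 2 * (-1 / (τ : ℂ)) = -2 / τ by ring, this,
      hs']
    simp
    ring
  · have := thetaJ_S τ (z - 1 / 2)
    rw [thetaJ_one_sub_half, thetaJ_one_sub_half] at this
    simp only [Fin.mk_one, Fin.val_one, Fin.isValue, Nat.cast_one, one_mul, one_pow,
      Pi.smul_apply, smul_eq_mul, Matrix.mulVec, dotProduct, Fin.sum_univ_two, Int.cast_one]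
    rw [show -1 / (τ : ℂ) + 2 * (z / (τ : ℂ)) = 2 * (z - 1 / 2) / τ by ring,
      show 2 * (-1 / (τ : ℂ)) = -2 / τ by ring, this, hs',
      show 2 * π * I * (z ^ 2 / τ) = 2 * π * I * (1 / 4 * (-1 / τ) + z / τ) +
        2 * π * I * ((z - 1 / 2) ^ 2 / τ) by ring, Complex.exp_add]
    simp
    ring

lemma exists_thetaMatrix (γ : SL(2, ℤ)) : ∃ U, IsThetaMatrix γ U := by
  have hmul : ∀ {γ γ' : SL(2, ℤ)}, (∃ U, IsThetaMatrix γ U) → (∃ U, IsThetaMatrix γ' U) →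
      ∃ U, IsThetaMatrix (γ * γ') U := by
    rintro γ γ' ⟨U, h⟩ ⟨U', h'⟩
    obtain ⟨ε, -, h⟩ := h.mul h'
    exact ⟨_, h⟩
  have hγ : γ ∈ Subgroup.closure {S, T} := by simp [SpecialLinearGroup.SL2Z_generators]
  have hS := exists_thetaMatrix_S
  have hT := exists_thetaMatrix_T
  have hST := hmul hS hT
  have hSi : S⁻¹ = S * (S * S) := by decide
  have hTi : T⁻¹ = S * (S * ((S * T) * ((S * T) * S))) := by decide
  induction hγ using Subgroup.closure_induction_left with
  | one =>
    rw [show (1 : SL(2, ℤ)) = S * S⁻¹ by simp, hSi]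
    exact hmul hS (hmul hS (hmul hS hS))
  | mul_left x hx y hy ih =>
    obtain rfl | rfl : x = S ∨ x = T := hx
    · exact hmul hS ih
    · exact hmul hT ih
  | inv_mul_cancel x hx y hy ih =>
    obtain rfl | rfl : x = S ∨ x = T := hx
    · rw [hSi]; exact hmul (hmul hS (hmul hS hS)) ih
    · rw [hTi]; exact hmul (hmul hS (hmul hS (hmul hST (hmul hST hS)))) ih


lemma thetaJ_one_ne_zero (r : ℕ) : thetaJ 1 r UpperHalfPlane.I 0 ≠ 0 := by
  have h := hasSum_thetaJ_one r UpperHalfPlane.I 0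
  have e : (fun n : ℤ => cexp (2 * π * I * (((n : ℂ) + r / 2) ^ 2 * (UpperHalfPlane.I : ℍ) +
      2 * ((n : ℂ) + r / 2) * 0))) =
      fun n : ℤ => ((Real.exp (-(2 * π * ((n : ℝ) + r / 2) ^ 2)) : ℝ) : ℂ) := by
    ext n
    rw [Complex.ofReal_exp, UpperHalfPlane.coe_I]
    congr 1
    push_cast
    linear_combination (2 * π * ((n : ℂ) + r / 2) ^ 2) * Complex.I_mul_I
  rw [e] at h
  have hs : Summable fun n : ℤ => Real.exp (-(2 * π * ((n : ℝ) + r / 2) ^ 2)) :=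
    Complex.summable_ofReal.mp h.summable
  rw [← h.tsum_eq, ← Complex.ofReal_tsum]
  exact Complex.ofReal_ne_zero.mpr
    (hs.tsum_pos (fun _ => (Real.exp_pos _).le) 0 (Real.exp_pos _)).ne'

lemma IsThetaMatrix.unique {γ : SL(2, ℤ)} {U U' : Matrix (Fin 2) (Fin 2) ℂ}
    (h : IsThetaMatrix γ U) (h' : IsThetaMatrix γ U') : U = U' := by
  have key : ∀ z i, (U.mulVec fun j : Fin 2 => thetaJ 1 j UpperHalfPlane.I z) i =
      (U'.mulVec fun j : Fin 2 => thetaJ 1 j UpperHalfPlane.I z) i := fun z i =>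
    mul_left_cancel₀ (mul_ne_zero (Complex.exp_ne_zero _) (sqrt_ne_zero (denom_ne_zero _ _)))
      ((h _ z i).symm.trans (h' _ z i))
  have n0 := thetaJ_one_ne_zero 0
  have n1 := thetaJ_one_ne_zero 1
  have key' : ∀ i, U i 0 = U' i 0 ∧ U i 1 = U' i 1 := by
    intro i
    have k0 := key 0 i
    have k1 := key (0 - 1 / 2) i
    simp only [Matrix.mulVec, dotProduct, Fin.sum_univ_two, thetaJ_one_sub_half, Fin.val_zero,
      Fin.val_one, pow_zero, pow_one] at k0 k1
    constructor
    · apply mul_right_cancel₀ n0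
      linear_combination (k0 + k1) / 2
    · apply mul_right_cancel₀ n1
      linear_combination (k0 - k1) / 2
  ext i j
  fin_cases j
  · exact (key' i).1
  · exact (key' i).2

lemma isThetaMatrix_one : IsThetaMatrix 1 1 := by
  intro τ z i
  have hd : denom ((1 : SL(2, ℤ)) : GL (Fin 2) ℝ) τ = 1 := by
    rw [ModularGroup.denom_apply]; simp
  rw [hd]
  simp

/-- The matrix `U_1(γ)` of the (projective) theta representation of index one: the unique matrix
through which `γ` acts on `(θ^J_{1,0}, θ^J_{1,1})`. -/
def weilMatrix (γ : SL(2, ℤ)) : Matrix (Fin 2) (Fin 2) ℂ :=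
  Classical.choose (exists_thetaMatrix γ)

lemma weilMatrix_spec (γ : SL(2, ℤ)) : IsThetaMatrix γ (weilMatrix γ) :=
  Classical.choose_spec (exists_thetaMatrix γ)

lemma det_weilMatrix_one : (weilMatrix 1).det = 1 := by
  rw [(weilMatrix_spec 1).unique isThetaMatrix_one, Matrix.det_one]

lemma det_weilMatrix_mul (γ γ' : SL(2, ℤ)) :
    (weilMatrix (γ * γ')).det = (weilMatrix γ).det * (weilMatrix γ').det := by
  obtain ⟨ε, hε, h⟩ := (weilMatrix_spec γ).mul (weilMatrix_spec γ')
  rw [(weilMatrix_spec (γ * γ')).unique h, Matrix.det_smul, Matrix.det_mul, Fintype.card_fin, hε,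
    one_mul]

lemma dvd_of_mem_Gamma0 {m : ℕ} (γ : CongruenceSubgroup.Gamma0 m) :
    (m : ℤ) ∣ (γ : SL(2, ℤ)) 1 0 :=
  (ZMod.intCast_zmod_eq_zero_iff_dvd _ m).mp (CongruenceSubgroup.Gamma0_mem.mp γ.2)

/-- For `γ = (a b; c d) ∈ Γ₀(m)`, the matrix `γ_m = (a bm; c/m d) ∈ SL₂(ℤ)`. -/
def conjByIndex (m : ℕ) (γ : CongruenceSubgroup.Gamma0 m) : SL(2, ℤ) :=
  ⟨!![(γ : SL(2, ℤ)) 0 0, (γ : SL(2, ℤ)) 0 1 * m; (γ : SL(2, ℤ)) 1 0 / m, (γ : SL(2, ℤ)) 1 1], by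
    have hd := (γ : SL(2, ℤ)).det_coe
    rw [Matrix.det_fin_two] at hd
    rw [Matrix.det_fin_two_of, mul_assoc, Int.mul_ediv_cancel' (dvd_of_mem_Gamma0 γ)]
    exact hd⟩

lemma conjByIndex_one (m : ℕ) : conjByIndex m 1 = 1 := by
  ext i j
  fin_cases i <;> fin_cases j <;> simp [conjByIndex]

lemma conjByIndex_mul (m : ℕ) (γ γ' : CongruenceSubgroup.Gamma0 m) :
    conjByIndex m (γ * γ') = conjByIndex m γ * conjByIndex m γ' := by
  obtain ⟨e, he⟩ := dvd_of_mem_Gamma0 γ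
  obtain ⟨e', he'⟩ := dvd_of_mem_Gamma0 γ'
  have hmul : ∀ i j, ((γ * γ' : CongruenceSubgroup.Gamma0 m) : SL(2, ℤ)) i j =
      (γ : SL(2, ℤ)) i 0 * (γ' : SL(2, ℤ)) 0 j + (γ : SL(2, ℤ)) i 1 * (γ' : SL(2, ℤ)) 1 j :=
    fun i j => by
      rw [Subgroup.coe_mul, Matrix.SpecialLinearGroup.coe_mul, Matrix.mul_apply, Fin.sum_univ_two]
  apply Subtype.ext
  rw [Matrix.SpecialLinearGroup.coe_mul]
  simp only [conjByIndex, hmul, he, he']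
  rw [Matrix.mul_fin_two]
  rw [show (m : ℤ) * e * (γ' : SL(2, ℤ)) 0 0 + (γ : SL(2, ℤ)) 1 1 * (m * e') =
    m * (e * (γ' : SL(2, ℤ)) 0 0 + (γ : SL(2, ℤ)) 1 1 * e') by ring]
  rcases eq_or_ne (m : ℤ) 0 with hm | hm
  · simp [hm]
  · simp only [Int.mul_ediv_cancel_left _ hm]
    ring_nf

/-- The character `ω_m(γ) = det U_1(γ_m)` of `Γ₀(m)`. -/
def omega (m : ℕ) : CongruenceSubgroup.Gamma0 m →* ℂ where
  toFun γ := (weilMatrix (conjByIndex m γ)).det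
  map_one' := by rw [conjByIndex_one, det_weilMatrix_one]
  map_mul' γ γ' := by rw [conjByIndex_mul, det_weilMatrix_mul]

lemma Gamma0_mul_le (m N : ℕ) :
    CongruenceSubgroup.Gamma0 (m * N) ≤ CongruenceSubgroup.Gamma0 m := fun γ hγ =>
  CongruenceSubgroup.Gamma0_mem.mpr <| (ZMod.intCast_zmod_eq_zero_iff_dvd _ m).mpr <|
    (Int.natCast_dvd_natCast.mpr (dvd_mul_right m N)).trans (dvd_of_mem_Gamma0 ⟨γ, hγ⟩)

/-- The character `χ · ω̄_m` of `Γ₀(mN)`, for a Dirichlet character `χ` modulo `mN`: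
`γ = (a b; c d) ↦ χ(d) · conj (ω_m(γ))`. -/
def chiOmegaBar (m N : ℕ) (χ : DirichletCharacter ℂ (m * N))
    (γ : CongruenceSubgroup.Gamma0 (m * N)) : ℂ :=
  χ (((γ : SL(2, ℤ)) 1 1 : ℤ) : ZMod (m * N)) *
    conj (omega m (Subgroup.inclusion (Gamma0_mul_le m N) γ))

/-! ### Modular forms with a character -/

/-- The space `M_k(Γ₀(M), v)` of modular forms of weight `k` for `Γ₀(M)` with character `v`:
holomorphic functions `f` on the upper half-plane with `f(γτ) = v(γ) (cτ + d)^k f(τ)` for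
`γ ∈ Γ₀(M)`, holomorphic at all cusps, that is, `f ∣[k] g` is bounded at `i∞` for all
`g ∈ SL₂(ℤ)`. -/
def modularForms (k : ℤ) (M : ℕ) (v : CongruenceSubgroup.Gamma0 M → ℂ) : Submodule ℂ (ℍ → ℂ) where
  carrier := {f | MDifferentiable 𝓘(ℂ) 𝓘(ℂ) f ∧
    (∀ γ : CongruenceSubgroup.Gamma0 M, f ∣[k] (γ : SL(2, ℤ)) = v γ • f) ∧
    ∀ g : SL(2, ℤ), IsBoundedAtImInfty (f ∣[k] g)}
  zero_mem' := ⟨mdifferentiable_const, fun γ => by simp, fun g => by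
    rw [SlashAction.zero_slash]
    exact Filter.const_boundedAtFilter _ 0⟩
  add_mem' := by
    rintro f f' ⟨h1, h2, h3⟩ ⟨h1', h2', h3'⟩
    refine ⟨h1.add h1', fun γ => ?_, fun g => ?_⟩
    · rw [SlashAction.add_slash, h2, h2', smul_add]
    · rw [SlashAction.add_slash]
      exact (h3 g).add (h3' g)
  smul_mem' := by
    rintro c f ⟨h1, h2, h3⟩
    refine ⟨h1.const_smul c, fun γ => ?_, fun g => ?_⟩
    · rw [ModularForm.SL_smul_slash, h2, smul_comm]
    · rw [ModularForm.SL_smul_slash]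
      exact (h3 g).smul c

/-! ### Jacobi forms -/

/-- The weight `k`, index `m` action of `γ = (a b; c d) ∈ SL₂(ℤ)` on functions on `ℍ × ℂ`:
`(φ|γ)(τ,z) = (cτ + d)^{-k} e(-m c z² / (cτ + d)) φ(γτ, z / (cτ + d))`. -/
def jacobiSlash (k : ℤ) (m : ℕ) (φ : ℍ → ℂ → ℂ) (γ : SL(2, ℤ)) : ℍ → ℂ → ℂ := fun τ z =>
  denom γ τ ^ (-k) * cexp (-(2 * π * I * (m * ((γ 1 0 : ℤ) * z ^ 2 / denom γ τ)))) *
    φ (γ • τ) (z / denom γ τ)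

/-- `φ` is holomorphic on `ℍ × ℂ`, jointly in both variables. -/
def IsHolomorphic (φ : ℍ → ℂ → ℂ) : Prop :=
  DifferentiableOn ℂ (fun p : ℂ × ℂ => φ (ofComplex p.1) p.2) {p | 0 < p.1.im}

/-- `φ` has an absolutely convergent Fourier expansion `∑ c(n,r) e(nτ + rz)`, with `r ∈ ℤ` and with
`n` rational of bounded denominator, in which `c(n,r) = 0` unless `n ≥ r² / 4m`. -/
def HasJacobiExpansion (m : ℕ) (φ : ℍ → ℂ → ℂ) : Prop :=
  ∃ c : ℚ → ℤ → ℂ,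
    (∃ M : ℕ, 0 < M ∧ ∀ n r, c n r ≠ 0 → ∃ j : ℤ, n = j / M) ∧
    (∀ n r, c n r ≠ 0 → (r : ℚ) ^ 2 / (4 * m) ≤ n) ∧
    ∀ (τ : ℍ) (z : ℂ), HasSum
      (fun p : ℚ × ℤ => c p.1 p.2 * cexp (2 * π * I * (p.1 * τ + p.2 * z))) (φ τ z)

lemma HasJacobiExpansion.zero (m : ℕ) : HasJacobiExpansion m 0 :=
  ⟨0, ⟨1, one_pos, fun _ _ h => absurd rfl h⟩, fun _ _ h => absurd rfl h,
    fun _ _ => by simp⟩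

lemma HasJacobiExpansion.add {m : ℕ} {φ ψ : ℍ → ℂ → ℂ} (h : HasJacobiExpansion m φ)
    (h' : HasJacobiExpansion m ψ) : HasJacobiExpansion m (φ + ψ) := by
  obtain ⟨c, ⟨M, hM, hd⟩, hc, hs⟩ := h
  obtain ⟨c', ⟨M', hM', hd'⟩, hc', hs'⟩ := h'
  have hor : ∀ n r, (c + c') n r ≠ 0 → c n r ≠ 0 ∨ c' n r ≠ 0 := by
    intro n r hne
    by_contra! hcon
    exact hne (by simp [hcon.1, hcon.2])
  have hMq : (M : ℚ) ≠ 0 := by positivity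
  have hMq' : (M' : ℚ) ≠ 0 := by positivity
  refine ⟨c + c', ⟨M * M', by positivity, fun n r hne => ?_⟩, fun n r hne => ?_, fun τ z => ?_⟩
  · rcases hor n r hne with h0 | h0
    · obtain ⟨j, rfl⟩ := hd n r h0
      exact ⟨j * M', by push_cast; field_simp⟩
    · obtain ⟨j, rfl⟩ := hd' n r h0
      exact ⟨j * M, by push_cast; field_simp⟩
  · rcases hor n r hne with h0 | h0
    · exact hc n r h0
    · exact hc' n r h0
  · simpa [add_mul] using (hs τ z).add (hs' τ z)

lemma HasJacobiExpansion.smul {m : ℕ} {φ : ℍ → ℂ → ℂ} (a : ℂ) (h : HasJacobiExpansion m φ) :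
    HasJacobiExpansion m (a • φ) := by
  obtain ⟨c, ⟨M, hM, hd⟩, hc, hs⟩ := h
  have hor : ∀ n r, (a • c) n r ≠ 0 → c n r ≠ 0 := fun n r hne h0 => hne (by simp [h0])
  exact ⟨a • c, ⟨M, hM, fun n r hne => hd n r (hor n r hne)⟩, fun n r hne => hc n r (hor n r hne),
    fun τ z => by simpa [mul_assoc] using (hs τ z).mul_left a⟩

/-- The space `J_{k,m}(Γ₀(M), χ)` of Jacobi forms of weight `k`, index `m` and character `χ` for the
Jacobi group `Γ₀(M) ⋉ ℤ²`: holomorphic functions on `ℍ × ℂ` with the modular and the elliptic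
transformation laws and with the usual Fourier expansion condition at every cusp. -/
def jacobiForms (k : ℤ) (m M : ℕ) (χ : DirichletCharacter ℂ M) : Submodule ℂ (ℍ → ℂ → ℂ) where
  carrier := {φ | IsHolomorphic φ ∧
    (∀ γ ∈ CongruenceSubgroup.Gamma0 M, jacobiSlash k m φ γ = χ ((γ 1 1 : ℤ) : ZMod M) • φ) ∧
    (∀ (l μ : ℤ) (τ : ℍ) (z : ℂ), φ τ (z + l * τ + μ) =
      cexp (-(2 * π * I * (m * (l ^ 2 * τ + 2 * l * z)))) * φ τ z) ∧
    ∀ g : SL(2, ℤ), HasJacobiExpansion m (jacobiSlash k m φ g)}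
  zero_mem' := by
    have h0 : ∀ g, jacobiSlash k m 0 g = 0 := fun g => by ext τ z; simp [jacobiSlash]
    refine ⟨differentiableOn_const 0, fun γ _ => by simp [h0], fun _ _ _ _ => by simp, fun g => ?_⟩
    rw [h0]
    exact HasJacobiExpansion.zero m
  add_mem' := by
    rintro φ ψ ⟨h1, h2, h3, h4⟩ ⟨h1', h2', h3', h4'⟩
    have ha : ∀ g, jacobiSlash k m (φ + ψ) g = jacobiSlash k m φ g + jacobiSlash k m ψ g :=
      fun g => by ext τ z; simp [jacobiSlash, mul_add]
    refine ⟨h1.add h1', fun γ hγ => ?_, fun l μ τ z => ?_, fun g => ?_⟩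
    · rw [ha, h2 γ hγ, h2' γ hγ, smul_add]
    · simp only [Pi.add_apply, h3, h3', mul_add]
    · rw [ha]
      exact (h4 g).add (h4' g)
  smul_mem' := by
    rintro a φ ⟨h1, h2, h3, h4⟩
    have ha : ∀ g, jacobiSlash k m (a • φ) g = a • jacobiSlash k m φ g :=
      fun g => by ext τ z; simp only [jacobiSlash, Pi.smul_apply, smul_eq_mul]; ring
    refine ⟨h1.const_smul a, fun γ hγ => ?_, fun l μ τ z => ?_, fun g => ?_⟩
    · rw [ha, h2 γ hγ, smul_comm]
    · simp only [Pi.smul_apply, h3, smul_eq_mul]; ring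
    · rw [ha]
      exact (h4 g).smul a

/-- `h` is the family of theta components of `φ`:
`φ(τ,z) = ∑_{0 ≤ r < 2m} h_{m,r}(τ) θ^J_{m,r}(τ,z)`. The family is indexed by the residues
`0, …, 2m - 1` and extended by zero. -/
def IsThetaDecomposition (m : ℕ) (φ : ℍ → ℂ → ℂ) (h : ℕ → ℍ → ℂ) : Prop :=
  (∀ r, 2 * m ≤ r → h r = 0) ∧
    ∀ (τ : ℍ) (z : ℂ), φ τ z = ∑ r ∈ Finset.range (2 * m), h r τ * thetaJ m r τ z

/-- The space `J*_{k,m}(Γ₀(M), χ)` of the Jacobi forms whose theta components `h_{m,r}` vanish for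
`r ≠ 0, m`. -/
def jacobiFormsStar (k : ℤ) (m M : ℕ) (χ : DirichletCharacter ℂ M) :
    Submodule ℂ (ℍ → ℂ → ℂ) where
  carrier := {φ | φ ∈ jacobiForms k m M χ ∧
    ∃ h, IsThetaDecomposition m φ h ∧ ∀ r, r ≠ 0 → r ≠ m → h r = 0}
  zero_mem' := ⟨Submodule.zero_mem _, 0, ⟨fun _ _ => rfl, fun _ _ => by simp⟩, fun _ _ _ => rfl⟩
  add_mem' := by
    rintro φ ψ ⟨h0, h, ⟨h1, h2⟩, h3⟩ ⟨h0', h', ⟨h1', h2'⟩, h3'⟩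
    refine ⟨Submodule.add_mem _ h0 h0', h + h', ⟨fun r hr => ?_, fun τ z => ?_⟩, fun r hr hr' => ?_⟩
    · rw [Pi.add_apply, h1 r hr, h1' r hr, add_zero]
    · simp only [Pi.add_apply, h2, h2', add_mul, Finset.sum_add_distrib]
    · rw [Pi.add_apply, h3 r hr hr', h3' r hr hr', add_zero]
  smul_mem' := by
    rintro a φ ⟨h0, h, ⟨h1, h2⟩, h3⟩
    refine ⟨Submodule.smul_mem _ a h0, a • h, ⟨fun r hr => ?_, fun τ z => ?_⟩, fun r hr hr' => ?_⟩
    · rw [Pi.smul_apply, h1 r hr, smul_zero]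
    · simp only [Pi.smul_apply, h2, smul_eq_mul, Finset.mul_sum, mul_assoc]
    · rw [Pi.smul_apply, h3 r hr hr', smul_zero]

/-- The restriction map `D_0 : φ ↦ φ(τ,0)`. -/
def restrictZero : (ℍ → ℂ → ℂ) →ₗ[ℂ] (ℍ → ℂ) where
  toFun φ τ := φ τ 0
  map_add' _ _ := rfl
  map_smul' _ _ := rfl

/-- The space `J*_{k,m}(Γ₀(M), χ)⁰ = J*_{k,m}(Γ₀(M), χ) ∩ ker D_0`. -/
def jacobiFormsStarKer (k : ℤ) (m M : ℕ) (χ : DirichletCharacter ℂ M) :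
    Submodule ℂ (ℍ → ℂ → ℂ) :=
  jacobiFormsStar k m M χ ⊓ LinearMap.ker restrictZero

end

end JacobiTheta

namespace JacobiTheta

/-! ### Fourier expansions of entire quasi-periodic functions -/

/-! A form `φ` in the source is `h_0 θ^J_{m,0} + h_m θ^J_{m,m}`, and its vanishing at `z = 0` says
`h_0 θ_{m,0} + h_m θ_{m,m} = 0`. The theta constants have no zeros, so `(h_0, h_m)` is a function
`f` times `(θ_{m,m}, -θ_{m,0})`, that is, `φ = f · thetaDet m` (`exists_eq_mulThetaDet`). It remains
to match the conditions on `f` with those on `f · thetaDet m`.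

The two theta series are those of index one at `(mτ, mz)`, and `thetaDet` is a determinant of two
values of the index one theta vector. It therefore transforms by `det U_1`, and the two factors
`(cτ+d)^{1/2}` combine to weight one: `thetaDet m` has weight 1, index `m` and character `ω_m` on
`Γ₀(m)`. This explains the weight `k - 1` and the character `χ ω̄_m`.

At the cusps one writes `diag(m,1) g = g' (A B; 0 D)`, so that `thetaDet m` becomes a constant times
`thetaDet 1` at `((Aτ+B)/D, Az)` (`thetaDet_smul`). If `f` is holomorphic at the cusps, multiplying
expansions gives the Jacobi condition (`mulThetaDet_mem`). Conversely, the coefficient of `e(Az)`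
isolates `f` times a factor of known size, and the inequality `n ≥ r²/4m` at `r = A` is exactly what
bounds `f` (`isBoundedAtImInfty_of_hasJacobiExpansion`).

Two inputs are proved separately. Fourier analysis of entire quasi-periodic functions
(`eq_sum_theta_series`) gives the theta decomposition. In its one-dimensional case it also gives a
product formula for `jacobiTheta₂` up to a constant, from which the theta constants are seen not to
vanish. -/

lemma exp_two_pi_I_int (n : ℤ) : cexp (2 * π * I * n) = 1 := by
  rw [mul_comm]; exact Complex.exp_int_mul_two_pi_mul_I n

/-- The integral of an entire function of period one over a period does not depend on the
horizontal segment chosen. -/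
lemma intervalIntegral_shift {h : ℂ → ℂ} (hd : Differentiable ℂ h) (hp : ∀ z, h (z + 1) = h z)
    (w : ℂ) : ∫ x : ℝ in (0 : ℝ)..1, h (x + w) = ∫ x : ℝ in (0 : ℝ)..1, h x := by
  -- The vertical sides of this rectangle cancel by periodicity; the real part of `w` is absorbed by
  -- periodicity along the horizontal line.
  have key := Complex.integral_boundary_rect_eq_zero_of_differentiableOn h 0 (1 + w.im * I)
    hd.differentiableOn
  have hper : Function.Periodic (fun x : ℝ => h (x + w.im * I)) 1 := fun x => by
    have := hp (x + w.im * I)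
    simp only
    rw [← this]
    congr 1; push_cast; ring
  have h1 : ∫ x : ℝ in (0 : ℝ)..1, h (x + w) = ∫ x : ℝ in (0 : ℝ)..1, h (x + w.im * I) := by
    have e : ∀ x : ℝ, h (x + w) = (fun x : ℝ => h (x + w.im * I)) (x + w.re) := fun x => by
      simp only
      conv_lhs => rw [← Complex.re_add_im w]
      congr 1; push_cast; ring
    simp_rw [e]
    rw [intervalIntegral.integral_comp_add_right (fun x : ℝ => h (x + w.im * I)), zero_add,
      add_comm (1 : ℝ), hper.intervalIntegral_add_eq w.re 0, zero_add]
  rw [h1]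
  have h2 : ∀ y : ℝ, h (1 + y * I) = h (y * I) := fun y => by rw [add_comm, hp]
  simp [h2] at key
  exact (sub_eq_zero.mp key).symm

/-- The Fourier coefficients of a function of period one, in terms of its restriction to `ℝ`. -/
noncomputable def fourierInt (f : ℂ → ℂ) (n : ℤ) : ℂ :=
  ∫ x : ℝ in (0 : ℝ)..1, f x * cexp (-(2 * π * I * (n * x)))

/-- The integrand `f(z) e(-nz)` is entire of period one, so its integral may be moved to the segment
through `w`. -/
lemma fourierInt_translate {f : ℂ → ℂ} (hd : Differentiable ℂ f) (hp : ∀ z, f (z + 1) = f z)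
    (n : ℤ) (w : ℂ) : fourierInt (fun z => f (z + w)) n = fourierInt f n *
      cexp (2 * π * I * (n * w)) := by
  have := intervalIntegral_shift (h := fun z => f z * cexp (-(2 * π * I * (n * z))))
    (by fun_prop) (fun z => by
      simp only [hp]
      congr 1
      rw [show -(2 * π * I * (n * (z + 1))) = -(2 * π * I * (n * z)) + 2 * π * I * ((-n : ℤ) : ℂ) by
        push_cast; ring, Complex.exp_add, exp_two_pi_I_int, mul_one]) w
  unfold fourierInt
  rw [← this, ← intervalIntegral.integral_mul_const]
  congr 1; ext x
  rw [mul_assoc (f _), ← Complex.exp_add]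
  congr 2; ring

/-- Complex `w` is reached by applying real Fourier inversion to `x ↦ f(x + w)` and evaluating at `x
= 0`. -/
lemma hasSum_fourierInt {f : ℂ → ℂ} (hd : Differentiable ℂ f) (hp : ∀ z, f (z + 1) = f z)
    (hs : ∀ w : ℂ, Summable fun n : ℤ => fourierInt f n * cexp (2 * π * I * (n * w))) (w : ℂ) :
    HasSum (fun n : ℤ => fourierInt f n * cexp (2 * π * I * (n * w))) (f w) := by
  have hper : Function.Periodic (fun x : ℝ => f (x + w)) 1 := fun x => by
    simp only
    rw [← hp (x + w)]; congr 1; push_cast; ring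
  let F : C(AddCircle (1 : ℝ), ℂ) := ⟨hper.lift, by
    refine continuous_coinduced_dom.mpr ?_
    change Continuous fun x : ℝ => f (x + w)
    exact hd.continuous.comp (by fun_prop)⟩
  have hc : ∀ n, fourierCoeff F n = fourierInt f n * cexp (2 * π * I * (n * w)) := fun n => by
    rw [← fourierInt_translate hd hp, fourierCoeff_eq_intervalIntegral F n 0]
    simp only [div_one, zero_add, one_smul, fourierInt]
    congr 1; ext x
    have : F (x : AddCircle (1 : ℝ)) = f (x + w) := rfl
    rw [this, fourier_coe_apply, smul_eq_mul, mul_comm]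
    congr 2; push_cast; ring
  have hF : Summable (fourierCoeff F) := by
    rw [show fourierCoeff F = _ from funext hc]; exact hs w
  have := has_pointwise_sum_fourier_series_of_summable hF ((0 : ℝ) : AddCircle (1 : ℝ))
  have h0 : F ((0 : ℝ) : AddCircle (1 : ℝ)) = f w := by
    change f ((0 : ℝ) + w) = f w
    simp
  rw [h0] at this
  convert! this using 2 with n
  rw [hc]
  simp

/-- An entire function of period one with the quasi-period `τ` and multiplier
`e(-Mτ/2 - Mz)` is a linear combination of the `M` theta series of that type. -/
lemma eq_sum_theta_series {M : ℕ} (hM : 0 < M) {τ : ℂ} (hτ : 0 < τ.im) {f : ℂ → ℂ}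
    (hd : Differentiable ℂ f) (hp : ∀ z, f (z + 1) = f z)
    (hq : ∀ z, f (z + τ) = cexp (-(2 * π * I * (M * τ / 2 + M * z))) * f z) :
    ∃ b : ℕ → ℂ, ∀ z, f z = ∑ r ∈ Finset.range M,
      b r * ∑' j : ℤ, cexp (2 * π * I * ((r + M * j) ^ 2 * τ / (2 * M) + (r + M * j) * z)) := by
  have hMc : (M : ℂ) ≠ 0 := by exact_mod_cast hM.ne'
  -- The Fourier coefficients of `f(z + τ)` are computed in two ways: by translation and by the
  -- multiplier.
  have hrec : ∀ n : ℤ, fourierInt f (n + M) =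
      fourierInt f n * cexp (2 * π * I * (n * τ + M * τ / 2)) := fun n => by
    rw [mul_add, Complex.exp_add, ← mul_assoc, ← fourierInt_translate hd hp]
    unfold fourierInt
    rw [← intervalIntegral.integral_mul_const]
    congr 1; ext x
    simp only [hq]
    rw [mul_comm (cexp _) (f x), mul_assoc (f x), mul_assoc (f x), ← Complex.exp_add, ← Complex.exp_add]
    congr 2; push_cast; ring
  -- Removing the Gaussian factor turns the recursion into periodicity modulo `M`. So `b` takes
  -- finitely many values, and the coefficients of `f` are dominated by a theta series.
  set b : ℤ → ℂ := fun n => fourierInt f n * cexp (-(2 * π * I * (n ^ 2 * τ / (2 * M)))) with hb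
  have hbp : Function.Periodic b (M : ℤ) := fun n => by
    simp only [hb, hrec]
    rw [mul_assoc, ← Complex.exp_add]
    congr 2; push_cast; field_simp; ring
  have hbmod : ∀ (j : ℤ) (r : ℕ), b (r + M * j) = b r := fun j r => by
    have := hbp.int_mul j r
    rwa [mul_comm] at this
  have hc : ∀ (n : ℤ) (w : ℂ), fourierInt f n * cexp (2 * π * I * (n * w)) =
      b n * jacobiTheta₂_term n w (τ / M) := fun n w => by
    simp only [hb, jacobiTheta₂_term]
    rw [mul_assoc (fourierInt f n), ← Complex.exp_add]
    congr 2; field_simp; ring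
  have hτM : 0 < (τ / M).im := by
    rw [Complex.div_natCast_im]; positivity
  have hs : ∀ w : ℂ, Summable fun n : ℤ => fourierInt f n * cexp (2 * π * I * (n * w)) := by
    intro w
    simp_rw [hc]
    refine Summable.of_norm_bounded (g := fun n => (∑ r ∈ Finset.range M, ‖b r‖) *
      ‖jacobiTheta₂_term n w (τ / M)‖)
      ((((summable_jacobiTheta₂_term_iff _ _).mpr hτM).norm).mul_left _) fun n => ?_
    rw [norm_mul]
    refine mul_le_mul_of_nonneg_right ?_ (norm_nonneg _)
    have h0 : 0 ≤ n % M := Int.emod_nonneg _ (by exact_mod_cast hM.ne')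
    have h1 : n % M < M := Int.emod_lt_of_pos _ (by exact_mod_cast hM)
    have h2 := hbmod (n / M) (n % M).toNat
    rw [Int.toNat_of_nonneg h0, Int.emod_add_mul_ediv] at h2
    rw [h2, ← Int.toNat_of_nonneg h0]
    exact Finset.single_le_sum (f := fun r : ℕ => ‖b r‖) (fun _ _ => norm_nonneg _)
      (Finset.mem_range.mpr (by omega))
  refine ⟨fun r => b r, fun z => ?_⟩
  have hf := hasSum_fourierInt hd hp hs z
  have : NeZero M := ⟨hM.ne'⟩
  rw [← ((Equiv.prodComm _ _).trans (Int.divModEquiv M).symm).hasSum_iff] at hf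
  have hf2 := (hf.prod_fiberwise fun r => (hf.summable.prod_factor r).hasSum)
  have := hf2.unique (hasSum_fintype _)
  rw [this, Finset.sum_range]
  refine Finset.sum_congr rfl fun r _ => ?_
  rw [← tsum_mul_left]
  refine tsum_congr fun j => ?_
  simp only [Function.comp_apply, Equiv.trans_apply, Equiv.prodComm_apply, Prod.swap_prod_mk,
    Int.divModEquiv_symm_apply]
  rw [hc, mul_comm j, add_comm, hbmod, jacobiTheta₂_term]
  congr 2
  push_cast
  field_simp
  ring

/-! ### Zeros of the theta constants -/

/-- The infinite product `∏_{n ≥ 0} (1 + q^{2n+1} w)`. -/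
noncomputable def oddProd (q w : ℂ) : ℂ := ∏' n : ℕ, (1 + q ^ (2 * n + 1) * w)

lemma summable_odd_pow {q : ℂ} (hq : ‖q‖ < 1) (w : ℂ) :
    Summable fun n : ℕ => ‖q ^ (2 * n + 1) * w‖ := by
  have h : Summable fun n : ℕ => ‖q‖ ^ n :=
    summable_geometric_of_lt_one (norm_nonneg _) hq
  have h2 := (h.comp_injective (i := fun n : ℕ => 2 * n + 1)
    fun a b hab => by simpa using hab).mul_right ‖w‖
  simpa [Function.comp_def] using h2

/-- With `q = e(τ/2)` and `w = e(z)`, the substitution `w ↦ q²w` is `z ↦ z + τ`; this is the source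
of the quasi-periodicity of the product. -/
lemma oddProd_eq_mul {q : ℂ} (hq : ‖q‖ < 1) (w : ℂ) :
    oddProd q w = (1 + q * w) * oddProd q (q ^ 2 * w) := by
  have hm : Multipliable fun n : ℕ => (1 + q ^ (2 * (n + 1) + 1) * w) :=
    multipliable_one_add_of_summable
      ((summable_nat_add_iff (f := fun n : ℕ => ‖q ^ (2 * n + 1) * w‖) 1).mpr
        (summable_odd_pow hq w))
  unfold oddProd
  rw [tprod_eq_zero_mul' (f := fun n : ℕ => 1 + q ^ (2 * n + 1) * w) hm]
  congr 1
  · simp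
  · refine tprod_congr fun n => ?_
    ring

lemma oddProd_ne_zero {q : ℂ} (hq : ‖q‖ < 1) {w : ℂ} (h : ∀ n : ℕ, 1 + q ^ (2 * n + 1) * w ≠ 0) :
    oddProd q w ≠ 0 :=
  tprod_one_add_ne_zero_of_summable h (summable_odd_pow hq w)

lemma one_add_ne_zero_of_norm_lt {u : ℂ} (hu : ‖u‖ < 1) : 1 + u ≠ 0 := fun h => by
  rw [add_comm, add_eq_zero_iff_eq_neg] at h
  rw [h] at hu
  simp at hu

lemma differentiable_oddProd {q : ℂ} (hq : ‖q‖ < 1) : Differentiable ℂ (oddProd q) := by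
  intro w₀
  have hopen : IsOpen (Metric.ball (0 : ℂ) (‖w₀‖ + 1)) := Metric.isOpen_ball
  have hl := (summable_odd_pow hq ((‖w₀‖ + 1 : ℝ) : ℂ)).hasProdLocallyUniformlyOn_nat_one_add
    (f := fun n w => q ^ (2 * n + 1) * w) hopen
    (.of_forall fun n w hw => by
      rw [norm_mul, norm_mul, Complex.norm_real, Real.norm_eq_abs, abs_of_nonneg (by positivity)]
      gcongr
      simpa using (mem_ball_zero_iff.mp hw).le)
    (fun n => by fun_prop)
  have hd : DifferentiableOn ℂ (oddProd q) (Metric.ball (0 : ℂ) (‖w₀‖ + 1)) :=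
    hl.differentiableOn (.of_forall fun _ => by
      simpa [Finset.prod_fn] using DifferentiableOn.finsetProd (fun _ _ => by fun_prop)) hopen
  exact hd.differentiableAt (hopen.mem_nhds (by simp))

lemma norm_exp_pi_I_mul_lt_one {τ : ℂ} (hτ : 0 < τ.im) : ‖cexp (π * I * τ)‖ < 1 := by
  rw [Complex.norm_exp, Real.exp_lt_one_iff]
  have : (π * I * τ : ℂ).re = -(π * τ.im) := by simp
  rw [this]
  have := mul_pos Real.pi_pos hτ
  linarith

/-- A weak form of the Jacobi triple product: `jacobiTheta₂` is, up to a factor independent of `z`,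
an infinite product. -/
lemma exists_oddProd_eq_mul_jacobiTheta₂ {τ : ℂ} (hτ : 0 < τ.im) : ∃ b : ℂ, ∀ z,
    oddProd (cexp (π * I * τ)) (cexp (2 * π * I * z)) *
      oddProd (cexp (π * I * τ)) (cexp (-(2 * π * I * z))) = b * jacobiTheta₂ z τ := by
  set q := cexp (π * I * τ) with hqdef
  have hq : ‖q‖ < 1 := norm_exp_pi_I_mul_lt_one hτ
  have hdiff := differentiable_oddProd hq
  -- For `M = 1` the space of quasi-periodic functions is one-dimensional. With `w = e(z)`, the
  -- multiplier arises from `1 + q⁻¹w⁻¹ = q⁻¹w⁻¹ (1 + qw)`.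
  obtain ⟨b, hb⟩ := eq_sum_theta_series one_pos hτ
    (f := fun z => oddProd q (cexp (2 * π * I * z)) * oddProd q (cexp (-(2 * π * I * z))))
    (by
      refine Differentiable.mul (hdiff.comp ?_) (hdiff.comp ?_) <;> fun_prop)
    (fun z => by
      have h1 : cexp (2 * π * I * (z + 1)) = cexp (2 * π * I * z) := by
        rw [mul_add, Complex.exp_add, mul_one, Complex.exp_two_pi_mul_I, mul_one]
      simp only [Complex.exp_neg, h1])
    (fun z => by
      have h1 : cexp (2 * π * I * (z + τ)) = q ^ 2 * cexp (2 * π * I * z) := by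
        rw [hqdef, ← Complex.exp_nat_mul, ← Complex.exp_add]; congr 1; push_cast; ring
      have h2 : q ^ 2 * cexp (-(2 * π * I * (z + τ))) = cexp (-(2 * π * I * z)) := by
        rw [hqdef, ← Complex.exp_nat_mul, ← Complex.exp_add]; congr 1; push_cast; ring
      have h3 : q * cexp (-(2 * π * I * (z + τ))) =
          cexp (-(2 * π * I * ((1 : ℕ) * τ / 2 + (1 : ℕ) * z))) := by
        rw [hqdef, ← Complex.exp_add]; congr 1; push_cast; ring
      have h4 : cexp (-(2 * π * I * ((1 : ℕ) * τ / 2 + (1 : ℕ) * z))) *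
          (q * cexp (2 * π * I * z)) = 1 := by
        rw [hqdef, ← Complex.exp_add, ← Complex.exp_add, ← Complex.exp_zero]
        congr 1; push_cast; ring
      rw [oddProd_eq_mul hq (cexp (-(2 * π * I * (z + τ)))), h2, h1, h3,
        oddProd_eq_mul hq (cexp (2 * π * I * z))]
      linear_combination -(oddProd q (q ^ 2 * cexp (2 * π * I * z)) *
        oddProd q (cexp (-(2 * π * I * z)))) * h4)
  refine ⟨b 0, fun z => ?_⟩
  have := hb z
  simp only [Finset.range_one, Finset.sum_singleton] at this
  rw [this, jacobiTheta₂]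
  congr 2; ext j
  rw [jacobiTheta₂_term]
  congr 1; push_cast; ring

/-- The constant `b` need not be known: a nonzero product forces both factors of `b * jacobiTheta₂`
to be nonzero. -/
lemma jacobiTheta₂_zero_ne_zero {τ : ℂ} (hτ : 0 < τ.im) : jacobiTheta₂ 0 τ ≠ 0 := by
  obtain ⟨b, hb⟩ := exists_oddProd_eq_mul_jacobiTheta₂ hτ
  have hq : ‖cexp (π * I * τ)‖ < 1 := norm_exp_pi_I_mul_lt_one hτ
  have h1 := oddProd_ne_zero hq (w := 1) fun n => by
    rw [mul_one]
    exact one_add_ne_zero_of_norm_lt (by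
      rw [norm_pow]; exact pow_lt_one₀ (norm_nonneg _) hq (by omega))
  have := hb 0
  simp only [mul_zero, neg_zero, Complex.exp_zero] at this
  intro h
  rw [h, mul_zero] at this
  exact mul_ne_zero h1 h1 this

lemma jacobiTheta₂_half_ne_zero {τ : ℂ} (hτ : 0 < τ.im) : jacobiTheta₂ (τ / 2) τ ≠ 0 := by
  obtain ⟨b, hb⟩ := exists_oddProd_eq_mul_jacobiTheta₂ hτ
  have hq : ‖cexp (π * I * τ)‖ < 1 := norm_exp_pi_I_mul_lt_one hτ
  set q := cexp (π * I * τ) with hqdef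
  have hq0 : q ≠ 0 := Complex.exp_ne_zero _
  have h1 := oddProd_ne_zero hq (w := q) fun n => by
    refine one_add_ne_zero_of_norm_lt ?_
    rw [← pow_succ, norm_pow]
    exact pow_lt_one₀ (norm_nonneg _) hq (by omega)
  -- At `w = q⁻¹` the first factor is `1 + 1 = 2`, and the rest is the product at `w = q`.
  have h2 : oddProd q q⁻¹ ≠ 0 := by
    rw [oddProd_eq_mul hq, mul_inv_cancel₀ hq0, pow_two, mul_assoc, mul_inv_cancel₀ hq0, mul_one]
    exact mul_ne_zero (by norm_num) h1
  have := hb (τ / 2)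
  rw [Complex.exp_neg, show 2 * π * I * (τ / 2) = π * I * τ by ring, ← hqdef] at this
  intro h
  rw [h, mul_zero] at this
  exact mul_ne_zero h1 h2 this

lemma im_two_mul_pos {m : ℕ} (hm : 0 < m) (τ : ℍ) : 0 < (2 * m * (τ : ℂ)).im := by
  have h : (2 * m * (τ : ℂ)).im = 2 * m * τ.im := by
    rw [show (2 * m : ℂ) = ((2 * m : ℝ) : ℂ) by push_cast; ring, Complex.im_ofReal_mul]
    rfl
  rw [h]
  have := τ.im_pos
  positivity

lemma thetaJ_eq {m : ℕ} (hm : 0 < m) (r : ℕ) (τ : ℍ) (z : ℂ) :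
    thetaJ m r τ z = cexp (2 * π * I * (r ^ 2 / (4 * m) * τ + r * z)) *
      jacobiTheta₂ (r * τ + 2 * m * z) (2 * m * τ) := by
  have hmc : (m : ℂ) ≠ 0 := by exact_mod_cast hm.ne'
  unfold thetaJ jacobiTheta₂ jacobiTheta₂_term
  rw [← tsum_mul_left]
  congr 1; ext n
  rw [← Complex.exp_add]
  congr 1; field_simp; ring

lemma theta_zero_ne_zero {m : ℕ} (hm : 0 < m) (τ : ℍ) : theta m 0 τ ≠ 0 := by
  rw [theta, thetaJ_eq hm]
  refine mul_ne_zero (Complex.exp_ne_zero _) ?_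
  simpa using jacobiTheta₂_zero_ne_zero (im_two_mul_pos hm τ)

lemma theta_self_ne_zero {m : ℕ} (hm : 0 < m) (τ : ℍ) : theta m m τ ≠ 0 := by
  rw [theta, thetaJ_eq hm]
  refine mul_ne_zero (Complex.exp_ne_zero _) ?_
  have := jacobiTheta₂_half_ne_zero (im_two_mul_pos hm τ)
  convert this using 2
  ring

/-! ### The theta decomposition -/

/-- The theta series are eigenfunctions of translation by `1/2m`, with distinct eigenvalues for `0 ≤
r < 2m`; this separates them. -/
lemma thetaJ_add_div {m : ℕ} (hm : 0 < m) (r j : ℕ) (τ : ℍ) (z : ℂ) :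
    thetaJ m r τ (z + j / (2 * m)) =
      cexp (2 * π * I * (r / (2 * m : ℕ))) ^ j * thetaJ m r τ z := by
  have hmc : (m : ℂ) ≠ 0 := by exact_mod_cast hm.ne'
  unfold thetaJ
  rw [← tsum_mul_left]
  congr 1; ext n
  rw [← Complex.exp_nat_mul, ← one_mul (cexp _ * cexp _), ← exp_two_pi_I_int (n * j),
    ← Complex.exp_add, ← Complex.exp_add]
  congr 1; push_cast; field_simp; ring

lemma exists_thetaJ_ne_zero {m : ℕ} (hm : 0 < m) (r : ℕ) (τ : ℍ) : ∃ z, thetaJ m r τ z ≠ 0 := by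
  have hmc : (m : ℂ) ≠ 0 := by exact_mod_cast hm.ne'
  refine ⟨-(r * τ / (2 * m)), ?_⟩
  rw [thetaJ_eq hm]
  refine mul_ne_zero (Complex.exp_ne_zero _) ?_
  rw [show (r * τ + 2 * m * -(r * τ / (2 * m)) : ℂ) = 0 by field_simp; ring]
  exact jacobiTheta₂_zero_ne_zero (im_two_mul_pos hm τ)

lemma exp_div_injective {M : ℕ} (hM : 0 < M) :
    Function.Injective fun r : Fin M => cexp (2 * π * I * ((r : ℕ) / M)) := by
  intro r s h
  have hp := Complex.isPrimitiveRoot_exp M hM.ne'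
  have e : ∀ r : ℕ, cexp (2 * π * I * (r / M)) = cexp (2 * π * I / M) ^ r := fun r => by
    rw [← Complex.exp_nat_mul]; congr 1; ring
  simp only [e] at h
  exact Fin.ext (hp.pow_inj r.2 s.2 h)

/-- The theta series `θ^J_{m,r}(τ, ·)`, `0 ≤ r < 2m`, are linearly independent. -/
lemma thetaJ_linearIndependent {m : ℕ} (hm : 0 < m) (τ : ℍ) {a : ℕ → ℂ}
    (h : ∀ z, ∑ r ∈ Finset.range (2 * m), a r * thetaJ m r τ z = 0) {r : ℕ} (hr : r < 2 * m) :
    a r = 0 := by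
  obtain ⟨z, hz⟩ := exists_thetaJ_ne_zero hm r τ
  have hv : (fun r : Fin (2 * m) => a r * thetaJ m r τ z) = 0 := by
    -- Vandermonde argument: the relation is evaluated at the translates `z + j/2m`, with the
    -- distinct eigenvalues as nodes.
    refine Matrix.eq_zero_of_forall_pow_sum_mul_pow_eq_zero (exp_div_injective (by omega))
      fun j => ?_
    have := h (z + (j : ℕ) / (2 * m))
    rw [Finset.sum_range] at this
    rw [← this]
    refine Finset.sum_congr rfl fun s _ => ?_
    rw [thetaJ_add_div hm]
    ring
  have := congrFun hv ⟨r, hr⟩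
  exact (mul_eq_zero.mp this).resolve_right hz

lemma IsThetaDecomposition.unique {m : ℕ} (hm : 0 < m) {φ : ℍ → ℂ → ℂ} {h h' : ℕ → ℍ → ℂ}
    (H : IsThetaDecomposition m φ h) (H' : IsThetaDecomposition m φ h') : h = h' := by
  funext r τ
  by_cases hr : r < 2 * m
  · refine sub_eq_zero.mp (thetaJ_linearIndependent hm τ (a := fun r => h r τ - h' r τ)
      (fun z => ?_) hr)
    simp only [sub_mul, Finset.sum_sub_distrib]
    rw [← H.2, ← H'.2, sub_self]
  · rw [H.1 r (by omega), H'.1 r (by omega)]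

lemma IsHolomorphic.differentiable {φ : ℍ → ℂ → ℂ} (h : IsHolomorphic φ) (τ : ℍ) :
    Differentiable ℂ (φ τ) := by
  intro z
  have hopen : IsOpen {p : ℂ × ℂ | 0 < p.1.im} :=
    isOpen_lt continuous_const (Complex.continuous_im.comp continuous_fst)
  have h1 : DifferentiableAt ℂ (fun p : ℂ × ℂ => φ (ofComplex p.1) p.2) ((τ : ℂ), z) :=
    h.differentiableAt (hopen.mem_nhds τ.im_pos)
  have h2 := DifferentiableAt.comp z h1
    ((differentiableAt_const (τ : ℂ)).prodMk differentiableAt_id)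
  simpa [Function.comp_def, ofComplex_apply] using h2

lemma exists_thetaDecomposition {k : ℤ} {m M : ℕ} (hm : 0 < m) {χ : DirichletCharacter ℂ M}
    {φ : ℍ → ℂ → ℂ} (hφ : φ ∈ jacobiForms k m M χ) : ∃ h, IsThetaDecomposition m φ h := by
  have hmc : (m : ℂ) ≠ 0 := by exact_mod_cast hm.ne'
  obtain ⟨hol, -, hell, -⟩ := hφ
  have key : ∀ τ : ℍ, ∃ b : ℕ → ℂ, ∀ z,
      φ τ z = ∑ r ∈ Finset.range (2 * m), b r * thetaJ m r τ z := fun τ => by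
    -- The elliptic law at `(l, μ) = (0, 1)` gives the period, and at `(1, 0)` the quasi-period with
    -- `M = 2m`.
    obtain ⟨b, hb⟩ := eq_sum_theta_series (M := 2 * m) (by omega) τ.im_pos (hol.differentiable τ)
      (fun z => by simpa using hell 0 1 τ z)
      (fun z => by
        have := hell 1 0 τ z
        simp only [Int.cast_one, one_mul, Int.cast_zero, add_zero] at this
        rw [this]
        congr 2; push_cast; ring)
    refine ⟨b, fun z => (hb z).trans (Finset.sum_congr rfl fun r _ => ?_)⟩
    unfold thetaJ
    congr 2; ext j; congr 1; push_cast; field_simp; ring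
  choose b hb using key
  refine ⟨fun r τ => if r < 2 * m then b τ r else 0, fun r hr => ?_, fun τ z => ?_⟩
  · funext τ
    simp [not_lt.mpr hr]
  · rw [hb]
    refine Finset.sum_congr rfl fun r hr => ?_
    simp only [if_pos (Finset.mem_range.mp hr)]

/-! ### The determinant of theta series -/

/-- The determinant `θ_{m,m}(τ) θ^J_{m,0}(τ,z) - θ_{m,0}(τ) θ^J_{m,m}(τ,z)`. -/
noncomputable def thetaDet (m : ℕ) (τ : ℍ) (z : ℂ) : ℂ :=
  theta m m τ * thetaJ m 0 τ z - theta m 0 τ * thetaJ m m τ z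

lemma thetaJ_zero_eq_index_one {m : ℕ} (hm : 0 < m) {τ σ : ℍ} (h : (σ : ℂ) = m * τ) (z : ℂ) :
    thetaJ m 0 τ z = thetaJ 1 0 σ (m * z) := by
  have hmc : (m : ℂ) ≠ 0 := by exact_mod_cast hm.ne'
  unfold thetaJ
  rw [h]
  congr 1; ext n; congr 1; push_cast; field_simp; ring

lemma thetaJ_self_eq_index_one {m : ℕ} (hm : 0 < m) {τ σ : ℍ} (h : (σ : ℂ) = m * τ) (z : ℂ) :
    thetaJ m m τ z = thetaJ 1 1 σ (m * z) := by
  have hmc : (m : ℂ) ≠ 0 := by exact_mod_cast hm.ne'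
  unfold thetaJ
  rw [h]
  congr 1; ext n; congr 1; push_cast; field_simp

lemma thetaDet_eq_index_one {m : ℕ} (hm : 0 < m) {τ σ : ℍ} (h : (σ : ℂ) = m * τ) (z : ℂ) :
    thetaDet m τ z = thetaDet 1 σ (m * z) := by
  simp only [thetaDet, theta, thetaJ_zero_eq_index_one hm h, thetaJ_self_eq_index_one hm h,
    mul_zero]

/-- `thetaDet 1` is the determinant with columns the theta vector at `z` and at `0`. Both columns
are multiplied by `U`, and the two equal square roots multiply to `cτ + d`; only the column at `z`
carries the exponential. -/
lemma IsThetaMatrix.thetaDet_smul {γ : SL(2, ℤ)} {U : Matrix (Fin 2) (Fin 2) ℂ}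
    (h : IsThetaMatrix γ U) (τ : ℍ) (z : ℂ) :
    thetaDet 1 (γ • τ) (z / denom γ τ) =
      cexp (2 * π * I * ((γ 1 0 : ℤ) * z ^ 2 / denom γ τ)) * denom γ τ * U.det *
        thetaDet 1 τ z := by
  have hs := sqrt_sq (denom γ τ)
  have h0 := h τ 0
  have hz := h τ z
  have h00 := h0 0
  have h01 := h0 1
  have hz0 := hz 0
  have hz1 := hz 1
  simp only [Matrix.mulVec, dotProduct, Fin.sum_univ_two, Fin.val_zero, Fin.val_one, zero_div,
    ne_eq, OfNat.ofNat_ne_zero, not_false_eq_true, zero_pow, mul_zero, Complex.exp_zero,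
    one_mul] at h00 h01 hz0 hz1
  simp only [thetaDet, theta, h00, h01, hz0, hz1, Matrix.det_fin_two]
  linear_combination (cexp (2 * π * I * ((γ 1 0 : ℤ) * z ^ 2 / denom γ τ)) *
    (U 0 0 * U 1 1 - U 0 1 * U 1 0) * (thetaJ 1 1 τ 0 * thetaJ 1 0 τ z -
      thetaJ 1 0 τ 0 * thetaJ 1 1 τ z)) * hs

/-! ### Behaviour of `thetaDet` at an arbitrary cusp. -/

/-- The action of `(A B; 0 D)` on the upper half-plane. -/
noncomputable def upperTri (A B D : ℤ) (hA : 0 < A) (hD : 0 < D) (τ : ℍ) : ℍ :=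
  ⟨(A * τ + B) / D, by
    have h : ((A * (τ : ℂ) + B) / D).im = A * τ.im / D := by
      rw [show (D : ℂ) = ((D : ℝ) : ℂ) by push_cast; rfl, Complex.div_ofReal_im]
      simp
    rw [h]
    have := τ.im_pos
    have h1 : (0 : ℝ) < A := by exact_mod_cast hA
    have h2 : (0 : ℝ) < D := by exact_mod_cast hD
    positivity⟩

lemma coe_upperTri (A B D : ℤ) (hA : 0 < A) (hD : 0 < D) (τ : ℍ) :
    (upperTri A B D hA hD τ : ℂ) = (A * τ + B) / D := rfl

/-- `diag(m, 1) g` is the product of an element of `SL₂(ℤ)` and an upper triangular matrix. -/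
lemma exists_upperTri_factorization {m : ℕ} (hm : 0 < m) (g : SL(2, ℤ)) :
    ∃ (g' : SL(2, ℤ)) (A B D : ℤ), 0 < A ∧ 0 < D ∧ A * D = m ∧ m * g 0 0 = g' 0 0 * A ∧
      m * g 0 1 = g' 0 0 * B + g' 0 1 * D ∧ g 1 0 = g' 1 0 * A ∧
      g 1 1 = g' 1 0 * B + g' 1 1 * D := by
  have hd : g 0 0 * g 1 1 - g 0 1 * g 1 0 = 1 := by
    have := g.det_coe
    rwa [Matrix.det_fin_two] at this
  have hm' : (0 : ℤ) < m := by exact_mod_cast hm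
  -- `A` is the content of the first column of `diag(m,1) g`. The primitive column left over is
  -- completed to `g'` by Bézout, and `B`, `D` are read off by applying `g'⁻¹` to the second column.
  have hgcd : 0 < Int.gcd (m * g 0 0) (g 1 0) := by
    refine Nat.pos_of_ne_zero fun h => ?_
    rw [Int.gcd_eq_zero_iff] at h
    have h0 : g 0 0 = 0 := (mul_eq_zero.mp h.1).resolve_left hm'.ne'
    rw [h0, h.2] at hd
    simp at hd
  obtain ⟨x, y, hxy, hx, hy⟩ := Int.exists_gcd_one hgcd
  set A : ℤ := (Int.gcd (m * g 0 0) (g 1 0) : ℤ) with hA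
  have hA0 : 0 < A := Int.natCast_pos.mpr hgcd
  obtain ⟨u, v, huv⟩ := Int.isCoprime_iff_gcd_eq_one.mpr hxy
  have hAD : A * (-(y * (m * g 0 1)) + x * g 1 1) = m := by
    linear_combination m * hd - g 1 1 * hx + m * g 0 1 * hy
  have hD : 0 < -(y * (m * g 0 1)) + x * g 1 1 :=
    pos_of_mul_pos_right (by rw [hAD]; exact hm') hA0.le
  refine ⟨⟨!![x, -v; y, u], by rw [Matrix.det_fin_two_of]; linear_combination huv⟩, A,
    u * (m * g 0 1) + v * g 1 1, -(y * (m * g 0 1)) + x * g 1 1, hA0, hD, hAD, ?_, ?_, ?_, ?_⟩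
  · simpa using hx
  · simp only [Matrix.of_apply, Matrix.cons_val', Matrix.cons_val_zero, Matrix.cons_val_one,
      Matrix.cons_val_fin_one]
    linear_combination -m * g 0 1 * huv
  · simpa using hy
  · simp only [Matrix.of_apply, Matrix.cons_val', Matrix.cons_val_zero, Matrix.cons_val_one,
      Matrix.cons_val_fin_one]
    linear_combination -g 1 1 * huv

/-- The transformation law of `thetaDet` under a general element of `SL₂(ℤ)`. -/
lemma thetaDet_smul {m : ℕ} (hm : 0 < m) {g g' : SL(2, ℤ)} {A B D : ℤ} (hA : 0 < A) (hD : 0 < D)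
    (hAD : A * D = m) (h00 : m * g 0 0 = g' 0 0 * A) (h01 : m * g 0 1 = g' 0 0 * B + g' 0 1 * D)
    (h10 : g 1 0 = g' 1 0 * A) (h11 : g 1 1 = g' 1 0 * B + g' 1 1 * D) (τ : ℍ) (z : ℂ) :
    thetaDet m (g • τ) (z / denom g τ) =
      cexp (2 * π * I * (m * ((g 1 0 : ℤ) * z ^ 2 / denom g τ))) * denom g τ *
        ((weilMatrix g').det / D) * thetaDet 1 (upperTri A B D hA hD τ) (A * z) := by
  set σ := upperTri A B D hA hD τ with hσdef
  have hσ : (σ : ℂ) = (A * τ + B) / D := rfl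
  have hAc : (A : ℂ) ≠ 0 := by exact_mod_cast hA.ne'
  have hDc : (D : ℂ) ≠ 0 := by exact_mod_cast hD.ne'
  have hmAD : (m : ℂ) = A * D := by exact_mod_cast hAD.symm
  have e00 : (m : ℂ) * g 0 0 = g' 0 0 * A := by exact_mod_cast h00
  have e01 : (m : ℂ) * g 0 1 = g' 0 0 * B + g' 0 1 * D := by exact_mod_cast h01
  have e10 : (g 1 0 : ℂ) = g' 1 0 * A := by exact_mod_cast h10
  have e11 : (g 1 1 : ℂ) = g' 1 0 * B + g' 1 1 * D := by exact_mod_cast h11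
  have hden : denom (g : GL (Fin 2) ℝ) τ = D * denom (g' : GL (Fin 2) ℝ) σ := by
    rw [ModularGroup.denom_apply, ModularGroup.denom_apply, hσ, e10, e11]
    field_simp
    ring
  have hne : denom (g' : GL (Fin 2) ℝ) σ ≠ 0 := denom_ne_zero _ _
  have hne' : (g' 1 0 : ℂ) * σ + g' 1 1 ≠ 0 := by rwa [ModularGroup.denom_apply] at hne
  have hne2 : (g 1 0 : ℂ) * τ + g 1 1 ≠ 0 := by
    have := denom_ne_zero (g : GL (Fin 2) ℝ) τ
    rwa [ModularGroup.denom_apply] at this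
  -- Both sides are the image of `τ` under `diag(m,1) g = g' (A B; 0 D)`.
  have hact : ((g' • σ : ℍ) : ℂ) = m * (g • τ : ℍ) := by
    have hden' := hden
    rw [ModularGroup.denom_apply, ModularGroup.denom_apply] at hden'
    rw [coe_specialLinearGroup_apply, coe_specialLinearGroup_apply]
    simp only [algebraMap_int_eq, eq_intCast, ofReal_intCast]
    rw [← mul_div_assoc, div_eq_div_iff hne' hne2, hden']
    have hn : (m : ℂ) * (g 0 0 * τ + g 0 1) = D * (g' 0 0 * σ + g' 0 1) := by
      rw [hσ, mul_add, ← mul_assoc, e00, e01]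
      field_simp
      ring
    rw [hn]
    ring
  rw [thetaDet_eq_index_one hm hact, hden,
    show (m : ℂ) * (z / (D * denom (g' : GL (Fin 2) ℝ) σ)) =
      (A * z) / denom (g' : GL (Fin 2) ℝ) σ by rw [hmAD]; field_simp,
    (weilMatrix_spec g').thetaDet_smul]
  rw [show (m : ℂ) * ((g 1 0 : ℤ) * z ^ 2 / (D * denom (g' : GL (Fin 2) ℝ) σ)) =
    (g' 1 0 : ℤ) * (A * z) ^ 2 / denom (g' : GL (Fin 2) ℝ) σ by rw [hmAD, e10]; field_simp]
  field_simp

/-- The transformation law of `thetaDet` under `Γ₀(m)`. -/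
lemma thetaDet_smul_of_mem_Gamma0 {m : ℕ} (hm : 0 < m) (γ : CongruenceSubgroup.Gamma0 m) (τ : ℍ)
    (z : ℂ) :
    thetaDet m ((γ : SL(2, ℤ)) • τ) (z / denom (γ : SL(2, ℤ)) τ) =
      cexp (2 * π * I * (m * (((γ : SL(2, ℤ)) 1 0 : ℤ) * z ^ 2 / denom (γ : SL(2, ℤ)) τ))) *
        denom (γ : SL(2, ℤ)) τ * omega m γ * thetaDet m τ z := by
  have hm' : (0 : ℤ) < m := by exact_mod_cast hm
  -- For `γ ∈ Γ₀(m)` the factorization is `diag(m,1) γ = γ_m diag(m,1)`: here `A = m`, `B = 0`, `D =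
  -- 1`.
  rw [thetaDet_smul hm (g' := conjByIndex m γ) (B := 0) hm' one_pos (by simp)
    (by simp [conjByIndex, mul_comm]) (by simp [conjByIndex, mul_comm])
    (by simp [conjByIndex, Int.ediv_mul_cancel (dvd_of_mem_Gamma0 γ)]) (by simp [conjByIndex]),
    thetaDet_eq_index_one hm (σ := upperTri m 0 1 hm' one_pos τ) (by simp [coe_upperTri])]
  simp [omega]

/-! ### Finite order of `ω_m`, and analytic properties of `thetaDet`. -/

/-- A character of `SL₂(ℤ)` is determined on `S` and `T`, and the relations `S⁴ = (ST)⁶ = 1` force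
its order to divide 12. Hence `ω_m` is unitary, and a bounded power of `T` suffices for periodicity
at the cusps. -/
lemma det_weilMatrix_pow (γ : SL(2, ℤ)) : (weilMatrix γ).det ^ 12 = 1 := by
  let f : SL(2, ℤ) →* ℂ :=
    { toFun γ := (weilMatrix γ).det
      map_one' := det_weilMatrix_one
      map_mul' := det_weilMatrix_mul }
  have hS4 : f S ^ 4 = 1 := by
    rw [← map_pow, show S ^ 4 = 1 by decide, map_one]
  have hS : f S ^ 12 = 1 := by
    rw [show 12 = 4 * 3 by norm_num, pow_mul, hS4, one_pow]
  have hST : f S ^ 6 * f T ^ 6 = 1 := by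
    rw [← mul_pow, ← map_mul, ← map_pow, show (S * T) ^ 6 = 1 by decide, map_one]
  have hT : f T ^ 12 = 1 := by
    have : (f S ^ 6 * f T ^ 6) ^ 2 = 1 := by rw [hST, one_pow]
    rw [mul_pow, ← pow_mul, ← pow_mul] at this
    norm_num at this
    rwa [hS, one_mul] at this
  have hγ : γ ∈ Subgroup.closure {S, T} := by simp [SpecialLinearGroup.SL2Z_generators]
  change f γ ^ 12 = 1
  induction hγ using Subgroup.closure_induction with
  | mem x hx =>
    obtain rfl | rfl : x = S ∨ x = T := hx
    · exact hS
    · exact hT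
  | one => simp
  | mul x y _ _ hx hy => rw [map_mul, mul_pow, hx, hy, one_mul]
  | inv x _ hx =>
    have : (f x⁻¹ * f x) ^ 12 = 1 := by rw [← map_mul, inv_mul_cancel, map_one, one_pow]
    rwa [mul_pow, hx, mul_one] at this

lemma det_weilMatrix_ne_zero (γ : SL(2, ℤ)) : (weilMatrix γ).det ≠ 0 := fun h => by
  have := det_weilMatrix_pow γ
  rw [h] at this
  norm_num at this

lemma omega_pow (m : ℕ) (γ : CongruenceSubgroup.Gamma0 m) : omega m γ ^ 12 = 1 :=
  det_weilMatrix_pow _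

lemma conj_omega_mul_self (m : ℕ) (γ : CongruenceSubgroup.Gamma0 m) :
    conj (omega m γ) * omega m γ = 1 := by
  have h : ‖omega m γ‖ = 1 := Complex.norm_eq_one_of_pow_eq_one (omega_pow m γ) (by norm_num)
  rw [Complex.conj_mul', h]
  norm_num

/-- Translation by `1/2m` fixes `θ^J_{m,0}` and negates `θ^J_{m,m}`, so the two terms add up instead
of cancelling. At this `z` one can divide by `thetaDet` for every `τ`. -/
lemma thetaDet_div_two {m : ℕ} (hm : 0 < m) (τ : ℍ) :
    thetaDet m τ (1 / (2 * m)) = 2 * theta m 0 τ * theta m m τ := by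
  have hmc : (m : ℂ) ≠ 0 := by exact_mod_cast hm.ne'
  have h0 := thetaJ_add_div hm 0 1 τ 0
  have h1 := thetaJ_add_div hm m 1 τ 0
  have e : cexp (2 * π * I * (m / (2 * m : ℕ))) = -1 := by
    rw [← Complex.exp_pi_mul_I]; congr 1; push_cast; field_simp
  rw [e] at h1
  simp only [Nat.cast_one, Nat.cast_zero, zero_div, mul_zero, Complex.exp_zero, zero_add,
    one_mul, pow_one] at h0 h1
  rw [thetaDet, h0, h1, ← theta, ← theta]
  ring

lemma thetaDet_div_two_ne_zero {m : ℕ} (hm : 0 < m) (τ : ℍ) :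
    thetaDet m τ (1 / (2 * m)) ≠ 0 := by
  rw [thetaDet_div_two hm]
  exact mul_ne_zero (mul_ne_zero two_ne_zero (theta_zero_ne_zero hm τ)) (theta_self_ne_zero hm τ)

lemma thetaDet_zero (m : ℕ) (τ : ℍ) : thetaDet m τ 0 = 0 := by
  rw [thetaDet, ← theta, ← theta]
  ring

lemma thetaJ_elliptic {m : ℕ} (hm : 0 < m) (r : ℕ) (l μ : ℤ) (τ : ℍ) (z : ℂ) :
    thetaJ m r τ (z + l * τ + μ) =
      cexp (-(2 * π * I * (m * (l ^ 2 * τ + 2 * l * z)))) * thetaJ m r τ z := by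
  have hmc : (m : ℂ) ≠ 0 := by exact_mod_cast hm.ne'
  unfold thetaJ
  rw [← tsum_mul_left, ← (Equiv.addRight l).tsum_eq (fun n : ℤ => cexp _ * cexp _)]
  congr 1; ext n
  rw [← one_mul (cexp _ * cexp _), ← exp_two_pi_I_int ((2 * m * n + r) * μ),
    ← Complex.exp_add, ← Complex.exp_add]
  congr 1
  simp only [Equiv.coe_addRight]
  push_cast; field_simp; ring

lemma thetaDet_elliptic {m : ℕ} (hm : 0 < m) (l μ : ℤ) (τ : ℍ) (z : ℂ) :
    thetaDet m τ (z + l * τ + μ) =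
      cexp (-(2 * π * I * (m * (l ^ 2 * τ + 2 * l * z)))) * thetaDet m τ z := by
  simp only [thetaDet, thetaJ_elliptic hm]
  ring

lemma isHolomorphic_thetaJ {m : ℕ} (hm : 0 < m) (r : ℕ) : IsHolomorphic (thetaJ m r) := by
  have hmc : (m : ℂ) ≠ 0 := by exact_mod_cast hm.ne'
  have h : DifferentiableOn ℂ (fun p : ℂ × ℂ => cexp (2 * π * I * (r ^ 2 / (4 * m) * p.1 + r * p.2)) *
      jacobiTheta₂ (r * p.1 + 2 * m * p.2) (2 * m * p.1)) {p | 0 < p.1.im} := by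
    intro p hp
    have h1 : DifferentiableAt ℂ (fun p : ℂ × ℂ => jacobiTheta₂ p.1 p.2)
        (r * p.1 + 2 * m * p.2, 2 * m * p.1) :=
      (hasFDerivAt_jacobiTheta₂ _ (im_two_mul_pos hm ⟨p.1, hp⟩)).differentiableAt
    have h2 := DifferentiableAt.comp p h1
      (f := fun p : ℂ × ℂ => (r * p.1 + 2 * m * p.2, 2 * m * p.1)) (by fun_prop)
    exact (DifferentiableAt.mul (by fun_prop) h2).differentiableWithinAt
  refine h.congr fun p hp => ?_
  rw [thetaJ_eq hm, ofComplex_apply_of_im_pos hp]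

lemma isHolomorphic_thetaDet {m : ℕ} (hm : 0 < m) : IsHolomorphic (thetaDet m) := by
  have h : ∀ r, DifferentiableOn ℂ (fun p : ℂ × ℂ => theta m r (ofComplex p.1))
      {p | 0 < p.1.im} := fun r =>
    DifferentiableOn.comp (t := {p : ℂ × ℂ | 0 < p.1.im}) (isHolomorphic_thetaJ hm r)
      (f := fun p : ℂ × ℂ => (p.1, (0 : ℂ))) (by fun_prop) fun p hp => hp
  exact ((h m).mul (isHolomorphic_thetaJ hm 0)).sub ((h 0).mul (isHolomorphic_thetaJ hm m))

/-! ### Fourier expansions of Jacobi forms -/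

/-- An expansion indexed by an arbitrary type can be collected into a Jacobi expansion. -/
lemma HasJacobiExpansion.of_hasSum {ι : Type*} {m M : ℕ} (hM : 0 < M) {φ : ℍ → ℂ → ℂ}
    (C : ι → ℂ) (N : ι → ℚ) (R : ι → ℤ) (hden : ∀ i, ∃ j : ℤ, N i = j / M)
    (hbd : ∀ i, (R i : ℚ) ^ 2 / (4 * m) ≤ N i)
    (hs : ∀ (τ : ℍ) (z : ℂ), HasSum
      (fun i => C i * cexp (2 * π * I * (N i * τ + R i * z))) (φ τ z)) :
    HasJacobiExpansion m φ := by
  let F : ι → ℚ × ℤ := fun i => (N i, R i)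
  have hne : ∀ n r, (∑' i : {i // F i = (n, r)}, C i) ≠ 0 → ∃ i, N i = n ∧ R i = r := by
    intro n r h
    by_contra! hcon
    have : IsEmpty {i // F i = (n, r)} :=
      ⟨fun ⟨i, hi⟩ => hcon i (congrArg Prod.fst hi) (congrArg Prod.snd hi)⟩
    exact h tsum_empty
  refine ⟨fun n r => ∑' i : {i // F i = (n, r)}, C i, ⟨M, hM, fun n r h => ?_⟩, fun n r h => ?_,
    fun τ z => ?_⟩
  · obtain ⟨i, rfl, rfl⟩ := hne n r h
    exact hden i
  · obtain ⟨i, rfl, rfl⟩ := hne n r h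
    exact hbd i
  · have h := (Equiv.sigmaFiberEquiv F).hasSum_iff.mpr (hs τ z)
    refine h.sigma fun p => ?_
    have h2 := (h.summable.sigma_factor p).hasSum
    have e : (∑' i : {i // F i = (p.1, p.2)}, C i) * cexp (2 * π * I * (p.1 * τ + p.2 * z)) =
        ∑' i : {i // F i = p}, C i * cexp (2 * π * I * (N i * τ + R i * z)) := by
      rw [← tsum_mul_right]
      refine tsum_congr fun ⟨i, hi⟩ => ?_
      have h1 : N i = p.1 := congrArg Prod.fst hi
      have h2 : R i = p.2 := congrArg Prod.snd hi
      simp only [h1, h2]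
    exact e ▸ h2

lemma hasSum_mul_complex {ι κ : Type*} {f : ι → ℂ} {g : κ → ℂ} {s t : ℂ} (hf : HasSum f s)
    (hg : HasSum g t) : HasSum (fun p : ι × κ => f p.1 * g p.2) (s * t) :=
  hf.mul hg (summable_mul_of_summable_norm hf.summable.norm hg.summable.norm)

lemma hasSum_thetaJ_one_upperTri (r : ℕ) {A B D : ℤ} (hA : 0 < A) (hD : 0 < D) (τ : ℍ) (z : ℂ) :
    HasSum (fun n : ℤ => cexp (2 * π * I * (((n : ℂ) + r / 2) ^ 2 * B / D)) *
      cexp (2 * π * I * (((n : ℂ) + r / 2) ^ 2 * A / D * τ + (2 * n + r) * A * z)))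
      (thetaJ 1 r (upperTri A B D hA hD τ) (A * z)) := by
  have h := hasSum_thetaJ_one r (upperTri A B D hA hD τ) (A * z)
  have hDc : (D : ℂ) ≠ 0 := by exact_mod_cast hD.ne'
  convert h using 2 with n
  rw [← Complex.exp_add, coe_upperTri]
  congr 1
  field_simp
  ring

/-- The terms of the series in `z` lie exactly on the parabola `n = r²/4m`, because `m = AD`; the
theta constant and `F` only add nonnegative exponents. -/
lemma hasJacobiExpansion_mul_theta {m H : ℕ} (hH : 0 < H) {A B D : ℤ} (hA : 0 < A)
    (hD : 0 < D) (hAD : A * D = m) {F : ℍ → ℂ} {a : ℕ → ℂ}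
    (hF : ∀ τ : ℍ, HasSum (fun j : ℕ => a j * cexp (2 * π * I * (j / H * τ))) (F τ)) (r s : ℕ) :
    HasJacobiExpansion m fun τ z => F τ * (theta 1 r (upperTri A B D hA hD τ) *
      thetaJ 1 s (upperTri A B D hA hD τ) (A * z)) := by
  have hDc : (D : ℂ) ≠ 0 := by exact_mod_cast hD.ne'
  have hDq : (D : ℚ) ≠ 0 := by exact_mod_cast hD.ne'
  have hAq : (0 : ℚ) < A := by exact_mod_cast hA
  have hDq' : (0 : ℚ) < D := by exact_mod_cast hD
  have hHq : (H : ℚ) ≠ 0 := by exact_mod_cast hH.ne'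
  have hmq : (m : ℚ) = A * D := by exact_mod_cast hAD.symm
  have hDn : (D.toNat : ℤ) = D := Int.toNat_of_nonneg hD.le
  have hDnq : (D.toNat : ℚ) = D := by exact_mod_cast hDn
  refine HasJacobiExpansion.of_hasSum (ι := ℕ × ℤ × ℤ) (M := 4 * D.toNat * H)
    (by have : 0 < D.toNat := by omega
        positivity)
    (fun i => a i.1 * (cexp (2 * π * I * (((i.2.1 : ℂ) + r / 2) ^ 2 * B / D)) *
      cexp (2 * π * I * (((i.2.2 : ℂ) + s / 2) ^ 2 * B / D))))
    (fun i => i.1 / H + ((i.2.1 + r / 2) ^ 2 * A / D + (i.2.2 + s / 2) ^ 2 * A / D))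
    (fun i => (2 * i.2.2 + s) * A) (fun i => ?_) (fun i => ?_) (fun τ z => ?_)
  · refine ⟨4 * D * i.1 + ((2 * i.2.1 + r) ^ 2 + (2 * i.2.2 + s) ^ 2) * A * H, ?_⟩
    push_cast
    rw [hDnq]
    field_simp
    ring
  · have e : (((2 * i.2.2 + s) * A : ℤ) : ℚ) ^ 2 / (4 * m) = (i.2.2 + s / 2) ^ 2 * A / D := by
      rw [hmq]
      push_cast
      field_simp
      ring
    rw [e]
    have h1 : (0 : ℚ) ≤ i.1 / H := by positivity
    have h2 : (0 : ℚ) ≤ (i.2.1 + r / 2) ^ 2 * A / D := by positivity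
    linarith
  · have h1 := hasSum_thetaJ_one_upperTri r (B := B) hA hD τ 0
    have h2 := hasSum_thetaJ_one_upperTri s (B := B) hA hD τ z
    rw [mul_zero, ← theta] at h1
    have h3 := hasSum_mul_complex h1 h2
    have h4 := hasSum_mul_complex (hF τ) h3
    refine h4.congr_fun fun i => ?_
    rw [show ∀ x y z u v w : ℂ, x * y * (z * u * (v * w)) = x * (z * v) * (y * (u * w)) by
      intros; ring, ← Complex.exp_add (2 * π * I * (((i.2.1 : ℂ) + r / 2) ^ 2 * A / D * τ +
        (2 * i.2.1 + r) * A * 0)), ← Complex.exp_add (2 * π * I * (i.1 / H * τ))]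
    congr 2
    push_cast
    ring

lemma hasJacobiExpansion_mul_thetaDet {m H : ℕ} (hH : 0 < H) {A B D : ℤ} (hA : 0 < A)
    (hD : 0 < D) (hAD : A * D = m) {F : ℍ → ℂ} {a : ℕ → ℂ}
    (hF : ∀ τ : ℍ, HasSum (fun j : ℕ => a j * cexp (2 * π * I * (j / H * τ))) (F τ)) (κ : ℂ) :
    HasJacobiExpansion m fun τ z => F τ * (κ * thetaDet 1 (upperTri A B D hA hD τ) (A * z)) := by
  convert ((hasJacobiExpansion_mul_theta (B := B) hH hA hD hAD hF 1 0).smul κ).add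
    ((hasJacobiExpansion_mul_theta (B := B) hH hA hD hAD hF 0 1).smul (-κ)) using 1
  ext τ z
  simp only [Pi.add_apply, Pi.smul_apply, smul_eq_mul, thetaDet]
  ring

/-! ### From modular forms to Jacobi forms -/

/-- The product of `f` and `thetaDet m` as a function on `ℍ × ℂ`. -/
noncomputable def mulThetaDet (m : ℕ) : (ℍ → ℂ) →ₗ[ℂ] (ℍ → ℂ → ℂ) where
  toFun f τ z := f τ * thetaDet m τ z
  map_add' f g := by ext τ z; simp [add_mul]
  map_smul' a f := by ext τ z; simp [mul_assoc]

lemma mulThetaDet_apply (m : ℕ) (f : ℍ → ℂ) (τ : ℍ) (z : ℂ) :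
    mulThetaDet m f τ z = f τ * thetaDet m τ z := rfl

/-- `thetaDet` absorbs the index and one unit of weight, leaving the weight `k - 1` slash of `f`.
The factor `E` covers both the `Γ₀(m)` case and the cusps. -/
lemma jacobiSlash_mulThetaDet_of_smul {k : ℤ} {m : ℕ} {g : SL(2, ℤ)} {τ : ℍ} {z E : ℂ}
    (h : thetaDet m (g • τ) (z / denom g τ) =
      cexp (2 * π * I * (m * ((g 1 0 : ℤ) * z ^ 2 / denom g τ))) * denom g τ * E) (f : ℍ → ℂ) :
    jacobiSlash k m (mulThetaDet m f) g τ z = (f ∣[k - 1] g) τ * E := by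
  have hne : denom (g : GL (Fin 2) ℝ) τ ≠ 0 := denom_ne_zero _ _
  rw [jacobiSlash, mulThetaDet_apply, h, ModularForm.SL_slash_apply, Complex.exp_neg,
    show -(k - 1) = -k + 1 by ring, zpow_add_one₀ hne]
  have := Complex.exp_ne_zero (2 * π * I * (m * ((g 1 0 : ℤ) * z ^ 2 / denom g τ)))
  field_simp

lemma jacobiSlash_mulThetaDet {k : ℤ} {m : ℕ} (hm : 0 < m) {g g' : SL(2, ℤ)} {A B D : ℤ}
    (hA : 0 < A) (hD : 0 < D) (hAD : A * D = m) (h00 : m * g 0 0 = g' 0 0 * A)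
    (h01 : m * g 0 1 = g' 0 0 * B + g' 0 1 * D) (h10 : g 1 0 = g' 1 0 * A)
    (h11 : g 1 1 = g' 1 0 * B + g' 1 1 * D) (f : ℍ → ℂ) (τ : ℍ) (z : ℂ) :
    jacobiSlash k m (mulThetaDet m f) g τ z = (f ∣[k - 1] g) τ *
      ((weilMatrix g').det / D * thetaDet 1 (upperTri A B D hA hD τ) (A * z)) :=
  jacobiSlash_mulThetaDet_of_smul
    (by rw [thetaDet_smul hm hA hD hAD h00 h01 h10 h11]; ring) f

lemma jacobiSlash_mulThetaDet_of_mem_Gamma0 {k : ℤ} {m : ℕ} (hm : 0 < m)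
    (γ : CongruenceSubgroup.Gamma0 m) (f : ℍ → ℂ) (τ : ℍ) (z : ℂ) :
    jacobiSlash k m (mulThetaDet m f) γ τ z =
      (f ∣[k - 1] (γ : SL(2, ℤ))) τ * (omega m γ * thetaDet m τ z) :=
  jacobiSlash_mulThetaDet_of_smul (by rw [thetaDet_smul_of_mem_Gamma0 hm]; ring) f

/-! ### Periodicity and Fourier expansions at the cusps. -/

lemma conj_T_zpow_apply (g : SL(2, ℤ)) (h : ℤ) :
    (g * T ^ h * g⁻¹) 1 0 = -(h * g 1 0 ^ 2) ∧ (g * T ^ h * g⁻¹) 1 1 = 1 + h * (g 0 0 * g 1 0) := by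
  have hd : g 0 0 * g 1 1 - g 0 1 * g 1 0 = 1 := by
    have := g.det_coe
    rwa [Matrix.det_fin_two] at this
  have e : ∀ j, (g * T ^ h * g⁻¹) 1 j =
      (g 1 0) * (g⁻¹) 0 j + (g 1 0 * h + g 1 1) * (g⁻¹) 1 j := fun j => by
    rw [Matrix.SpecialLinearGroup.coe_mul, Matrix.SpecialLinearGroup.coe_mul, coe_T_zpow]
    simp [Matrix.mul_apply, Fin.sum_univ_two]
  rw [e, e, Matrix.SpecialLinearGroup.coe_inv, Matrix.adjugate_fin_two]
  constructor
  · simp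
    ring
  · simp
    linear_combination hd

lemma conj_T_zpow_mem_Gamma0 (g : SL(2, ℤ)) {M : ℕ} {h : ℤ} (hh : (M : ℤ) ∣ h) :
    g * T ^ h * g⁻¹ ∈ CongruenceSubgroup.Gamma0 M := by
  rw [CongruenceSubgroup.Gamma0_mem, ZMod.intCast_zmod_eq_zero_iff_dvd, (conj_T_zpow_apply g h).1]
  exact (hh.mul_right _).neg_right

/-- The factor `mN` puts the conjugate in `Γ₀(mN)` with lower right entry `1` modulo `mN`, which
trivializes `χ`; the factor 12 makes it a twelfth power there, which trivializes `ω_m`. -/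
lemma chiOmegaBar_conj_T_zpow {m N : ℕ} (χ : DirichletCharacter ℂ (m * N)) (g : SL(2, ℤ))
    (hmem : g * T ^ (12 * (m * N : ℕ) : ℤ) * g⁻¹ ∈ CongruenceSubgroup.Gamma0 (m * N)) :
    chiOmegaBar m N χ ⟨_, hmem⟩ = 1 := by
  have h1 : g * T ^ ((m * N : ℕ) : ℤ) * g⁻¹ ∈ CongruenceSubgroup.Gamma0 (m * N) :=
    conj_T_zpow_mem_Gamma0 g dvd_rfl
  have hpow : (⟨_, hmem⟩ : CongruenceSubgroup.Gamma0 (m * N)) = ⟨_, h1⟩ ^ 12 := by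
    apply Subtype.ext
    simp only [SubmonoidClass.mk_pow, conj_pow]
    rw [mul_comm 12, zpow_mul]
    rfl
  have hd : ((((g * T ^ (12 * (m * N : ℕ) : ℤ) * g⁻¹) 1 1 : ℤ)) : ZMod (m * N)) = 1 := by
    have h0 : (m : ZMod (m * N)) * N = 0 := by rw [← Nat.cast_mul, ZMod.natCast_self]
    rw [(conj_T_zpow_apply g _).2]
    simp [h0]
  rw [chiOmegaBar]
  simp only [hd, map_one, one_mul]
  rw [hpow, map_pow, map_pow, omega_pow, map_one]

lemma modularForms_slash_periodic {k : ℤ} {m N : ℕ} {χ : DirichletCharacter ℂ (m * N)}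
    {f : ℍ → ℂ} (hf : f ∈ modularForms k (m * N) (chiOmegaBar m N χ)) (g : SL(2, ℤ)) :
    Function.Periodic ((f ∣[k] g) ∘ ofComplex) ((12 * (m * N) : ℕ) : ℝ) := by
  have hinv : (f ∣[k] g) ∣[k] (T ^ (12 * (m * N : ℕ) : ℤ)) = f ∣[k] g := by
    have hmem : g * T ^ (12 * (m * N : ℕ) : ℤ) * g⁻¹ ∈ CongruenceSubgroup.Gamma0 (m * N) :=
      conj_T_zpow_mem_Gamma0 g (dvd_mul_left _ _)
    have h := hf.2.1 ⟨_, hmem⟩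
    rw [chiOmegaBar_conj_T_zpow, one_smul] at h
    rw [← SlashAction.slash_mul]
    conv_rhs => rw [← h, ← SlashAction.slash_mul]
    simp
  intro w
  by_cases! hw : 0 < w.im
  · have hw' : 0 < (w + ((12 * (m * N) : ℕ) : ℝ)).im := by simpa using hw
    simp only [Function.comp_apply, ofComplex_apply_of_im_pos hw', ofComplex_apply_of_im_pos hw]
    have h := congrFun hinv ⟨w, hw⟩
    rw [ModularForm.SL_slash_apply] at h
    have hden : denom ((T ^ (12 * (m * N : ℕ) : ℤ) : SL(2, ℤ)) : GL (Fin 2) ℝ) (⟨w, hw⟩ : ℍ) = 1 := by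
      rw [ModularGroup.denom_apply, coe_T_zpow]
      simp
    rw [hden, one_zpow, mul_one] at h
    rw [← h]
    refine congrArg (f ∣[k] g) (UpperHalfPlane.ext ?_)
    rw [coe_T_zpow_smul_eq]
    simp
  -- Outside the half-plane `ofComplex` takes one constant default value.
  · have hw' : (w + ((12 * (m * N) : ℕ) : ℝ)).im ≤ 0 := by simpa using hw
    simp only [Function.comp_apply, ofComplex_apply_of_im_nonpos hw', ofComplex_apply_of_im_nonpos hw]

lemma exists_hasSum_slash {k : ℤ} {m N : ℕ} (hmN : 0 < m * N) {χ : DirichletCharacter ℂ (m * N)}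
    {f : ℍ → ℂ} (hf : f ∈ modularForms k (m * N) (chiOmegaBar m N χ)) (g : SL(2, ℤ)) :
    ∃ a : ℕ → ℂ, ∀ τ : ℍ, HasSum
      (fun j : ℕ => a j * cexp (2 * π * I * (j / (12 * (m * N) : ℕ) * τ))) ((f ∣[k] g) τ) := by
  have hH : (0 : ℝ) < ((12 * (m * N) : ℕ) : ℝ) := by exact_mod_cast (by omega : 0 < 12 * (m * N))
  refine ⟨fun j => (qExpansion ((12 * (m * N) : ℕ) : ℝ) (f ∣[k] g)).coeff j, fun τ => ?_⟩
  have h := UpperHalfPlane.hasSum_qExpansion hH (modularForms_slash_periodic hf g)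
    (MDifferentiable.slash hf.1 k g) (hf.2.2 g) τ
  convert h using 2 with j
  rw [smul_eq_mul, Function.Periodic.qParam, ← Complex.exp_nat_mul]
  congr 2
  push_cast
  ring

lemma mulThetaDet_isThetaDecomposition {m : ℕ} (hm : 0 < m) (f : ℍ → ℂ) :
    IsThetaDecomposition m (mulThetaDet m f) fun r τ =>
      if r = 0 then f τ * theta m m τ else if r = m then -(f τ * theta m 0 τ) else 0 := by
  refine ⟨fun r hr => ?_, fun τ z => ?_⟩
  · funext τ
    simp only [if_neg (show r ≠ 0 by omega), if_neg (show r ≠ m by omega)]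
    rfl
  · rw [← Finset.sum_subset (s₁ := {0, m})
      (fun r hr => by
        rcases Finset.mem_insert.mp hr with rfl | hr
        · exact Finset.mem_range.mpr (by omega)
        · rw [Finset.mem_singleton.mp hr]
          exact Finset.mem_range.mpr (by omega))
      (fun r _ hr => by
        simp only [Finset.mem_insert, Finset.mem_singleton, not_or] at hr
        simp [hr.1, hr.2]),
      Finset.sum_pair hm.ne]
    simp only [if_true, if_neg hm.ne', mulThetaDet_apply, thetaDet]
    ring

lemma mulThetaDet_mem {k : ℤ} {m N : ℕ} (hm : 0 < m) (hN : 0 < N)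
    {χ : DirichletCharacter ℂ (m * N)} {f : ℍ → ℂ}
    (hf : f ∈ modularForms (k - 1) (m * N) (chiOmegaBar m N χ)) :
    mulThetaDet m f ∈ jacobiFormsStarKer k m (m * N) χ := by
  refine ⟨⟨⟨?_, fun γ hγ => ?_, fun l μ τ z => ?_, fun g => ?_⟩, _,
    mulThetaDet_isThetaDecomposition hm f, fun r hr hr' => ?_⟩, ?_⟩
  · have h1 := UpperHalfPlane.mdifferentiable_iff.mp hf.1
    have h2 : DifferentiableOn ℂ (fun p : ℂ × ℂ => f (ofComplex p.1)) {p | 0 < p.1.im} :=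
      h1.comp (f := fun p : ℂ × ℂ => p.1) (by fun_prop) fun p hp => hp
    exact DifferentiableOn.mul h2 (isHolomorphic_thetaDet hm)
  · funext τ z
    have h := congrFun (hf.2.1 ⟨γ, hγ⟩) τ
    have h2 := jacobiSlash_mulThetaDet_of_mem_Gamma0 (k := k) hm
      (Subgroup.inclusion (Gamma0_mul_le m N) ⟨γ, hγ⟩) f τ z
    have h3 := conj_omega_mul_self m (Subgroup.inclusion (Gamma0_mul_le m N) ⟨γ, hγ⟩)
    simp only [Subgroup.coe_inclusion] at h2
    rw [h2, h]
    simp only [Pi.smul_apply, smul_eq_mul, chiOmegaBar, mulThetaDet_apply]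
    linear_combination (χ ((γ 1 1 : ℤ) : ZMod (m * N)) * f τ * thetaDet m τ z) * h3
  · simp only [mulThetaDet_apply, thetaDet_elliptic hm]
    ring
  · obtain ⟨g', A, B, D, hA, hD, hAD, h00, h01, h10, h11⟩ := exists_upperTri_factorization hm g
    have hmN : 0 < m * N := by positivity
    obtain ⟨a, ha⟩ := exists_hasSum_slash hmN hf g
    have := hasJacobiExpansion_mul_thetaDet (B := B) (by omega) hA hD hAD ha
      ((weilMatrix g').det / D)
    convert this using 3 with τ z
    exact jacobiSlash_mulThetaDet hm hA hD hAD h00 h01 h10 h11 f _ _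
  · funext τ
    simp only [if_neg hr, if_neg hr']
    rfl
  · refine LinearMap.mem_ker.mpr (funext fun τ => ?_)
    change mulThetaDet m f τ 0 = 0
    rw [mulThetaDet_apply, thetaDet_zero, mul_zero]

/-! ### From Jacobi forms to modular forms -/

lemma integral_exp_int_sub (r s : ℤ) :
    ∫ x : ℝ in (0 : ℝ)..1, cexp (2 * π * I * (r * x)) * cexp (-(2 * π * I * (s * x))) =
      if r = s then 1 else 0 := by
  have e : ∀ x : ℝ, cexp (2 * π * I * (r * x)) * cexp (-(2 * π * I * (s * x))) =
      cexp (2 * π * I * ((r - s : ℤ) : ℂ) * x) := fun x => by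
    rw [← Complex.exp_add]; congr 1; push_cast; ring
  simp_rw [e]
  split_ifs with h
  · simp [h]
  · have hne : 2 * π * I * ((r - s : ℤ) : ℂ) ≠ 0 :=
      mul_ne_zero Complex.two_pi_I_ne_zero (by exact_mod_cast sub_ne_zero.mpr h)
    rw [integral_exp_mul_complex hne, ofReal_one, mul_one, exp_two_pi_I_int]
    simp

/-- Fourier coefficients of an absolutely convergent trigonometric series. -/
lemma hasSum_fourierInt_trigSeries {ι : Type*} [Countable ι] {C : ι → ℂ} {R : ι → ℤ} {f : ℂ → ℂ}
    (h : ∀ z, HasSum (fun i => C i * cexp (2 * π * I * (R i * z))) (f z)) (s : ℤ) :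
    HasSum (fun i => if R i = s then C i else 0) (fourierInt f s) := by
  let F : ι → C(ℝ, ℂ) := fun i =>
    ⟨fun x => C i * (cexp (2 * π * I * (R i * x)) * cexp (-(2 * π * I * (s * x)))), by fun_prop⟩
  have hC : Summable C := by simpa using (h 0).summable
  have hn : ∀ (r : ℤ) (x : ℝ), ‖cexp (2 * π * I * (r * x))‖ = 1 := fun r x => by
    rw [show 2 * π * I * (r * x) = ((2 * π * (r * x) : ℝ) : ℂ) * I by push_cast; ring,
      Complex.norm_exp_ofReal_mul_I]
  have hF : Summable fun i => ‖(F i).restrict (⟨Set.uIcc 0 1, isCompact_uIcc⟩ :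
      TopologicalSpace.Compacts ℝ)‖ := by
    refine Summable.of_nonneg_of_le (fun _ => norm_nonneg _) (fun i => ?_) hC.norm
    refine (ContinuousMap.norm_le _ (norm_nonneg _)).mpr fun x => ?_
    change ‖C i * (cexp (2 * π * I * (R i * (x : ℝ))) * cexp (-(2 * π * I * (s * (x : ℝ)))))‖ ≤ _
    rw [norm_mul, norm_mul, hn, Complex.exp_neg, norm_inv, hn]
    simp
  have := intervalIntegral.hasSum_intervalIntegral_of_summable_norm hF
  have e1 : (fun i => ∫ x : ℝ in (0 : ℝ)..1, F i x) = fun i => if R i = s then C i else 0 := by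
    funext i
    change ∫ x : ℝ in (0 : ℝ)..1, C i * (cexp (2 * π * I * (R i * x)) *
      cexp (-(2 * π * I * (s * x)))) = _
    rw [intervalIntegral.integral_const_mul, integral_exp_int_sub]
    simp
  have e2 : ∫ x : ℝ in (0 : ℝ)..1, ∑' i, F i x = fourierInt f s := by
    refine intervalIntegral.integral_congr fun x _ => ?_
    change ∑' i, C i * (cexp (2 * π * I * (R i * x)) * cexp (-(2 * π * I * (s * x)))) = f x * _
    simp_rw [← mul_assoc (C _)]
    rw [tsum_mul_right, (h x).tsum_eq]
  rwa [e1, e2] at this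

lemma fourierInt_sub {f g : ℂ → ℂ} (hf : Continuous f) (hg : Continuous g) (a b : ℂ) (s : ℤ) :
    fourierInt (fun z => a * f z - b * g z) s = a * fourierInt f s - b * fourierInt g s := by
  unfold fourierInt
  rw [← intervalIntegral.integral_const_mul, ← intervalIntegral.integral_const_mul,
    ← intervalIntegral.integral_sub]
  · congr 1; ext x; ring
  all_goals exact Continuous.intervalIntegrable (by fun_prop) _ _

lemma hasSum_thetaJ_one_mul (r : ℕ) (A : ℤ) (σ : ℍ) (z : ℂ) :
    HasSum (fun n : ℤ => cexp (2 * π * I * (((n : ℂ) + r / 2) ^ 2 * σ)) *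
      cexp (2 * π * I * (((2 * n + r) * A : ℤ) * z))) (thetaJ 1 r σ (A * z)) := by
  convert hasSum_thetaJ_one r σ (A * z) using 2 with n
  rw [← Complex.exp_add]
  congr 1; push_cast; ring

lemma continuous_thetaJ_mul {m : ℕ} (hm : 0 < m) (r : ℕ) (a : ℂ) (σ : ℍ) :
    Continuous fun z => thetaJ m r σ (a * z) :=
  ((isHolomorphic_thetaJ hm r).differentiable σ).continuous.comp (by fun_prop)

lemma fourierInt_thetaJ_zero {A : ℤ} (hA : 0 < A) (σ : ℍ) :
    fourierInt (fun z => thetaJ 1 0 σ (A * z)) A = 0 := by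
  refine (hasSum_fourierInt_trigSeries (hasSum_thetaJ_one_mul 0 A σ) A).unique ?_
  have h : ∀ n : ℤ, ¬ (2 * n + (0 : ℕ)) * A = A := fun n hn => by
    have : 2 * n + (0 : ℕ) = 1 := mul_right_cancel₀ hA.ne' (by rw [hn, one_mul])
    omega
  simp only [if_neg (h _)]
  exact hasSum_zero

lemma fourierInt_thetaJ_one {A : ℤ} (hA : 0 < A) (σ : ℍ) :
    fourierInt (fun z => thetaJ 1 1 σ (A * z)) A = cexp (2 * π * I * (σ / 4)) := by
  refine (hasSum_fourierInt_trigSeries (hasSum_thetaJ_one_mul 1 A σ) A).unique ?_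
  have h : ∀ n : ℤ, n ≠ 0 → ¬ (2 * n + (1 : ℕ)) * A = A := fun n h0 hn => by
    have : 2 * n + (1 : ℕ) = 1 := mul_right_cancel₀ hA.ne' (by rw [hn, one_mul])
    omega
  convert hasSum_single (0 : ℤ) (f := fun n : ℤ => if (2 * n + (1 : ℕ)) * A = A then
    cexp (2 * π * I * (((n : ℂ) + (1 : ℕ) / 2) ^ 2 * σ)) else 0) fun n hn => if_neg (h n hn) using 1
  simp only [mul_zero, zero_add, Nat.cast_one, one_mul, if_true, Int.cast_zero]
  congr 1; ring

/-- In `z` the frequencies of `θ^J_{1,0}` are even multiples of `A` and those of `θ^J_{1,1}` odd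
ones, so frequency `A` picks out one exponential. Its cofactor `θ_{1,0}(σ)` stays away from zero
high in the half-plane. -/
lemma fourierInt_thetaDet {A : ℤ} (hA : 0 < A) (σ : ℍ) (a : ℂ) :
    fourierInt (fun z => a * thetaDet 1 σ (A * z)) A =
      -(a * theta 1 0 σ * cexp (2 * π * I * (σ / 4))) := by
  have e : (fun z => a * thetaDet 1 σ (A * z)) = fun z => a * theta 1 1 σ * thetaJ 1 0 σ (A * z) -
      a * theta 1 0 σ * thetaJ 1 1 σ (A * z) := by
    funext z; rw [thetaDet]; ring
  rw [e, fourierInt_sub (continuous_thetaJ_mul one_pos _ _ _) (continuous_thetaJ_mul one_pos _ _ _),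
    fourierInt_thetaJ_zero hA, fourierInt_thetaJ_one hA]
  ring

lemma half_le_norm_theta {σ : ℍ} (h : 1 ≤ σ.im) : 1 / 2 ≤ ‖theta 1 0 σ‖ := by
  have him : 0 < (2 * (1 : ℕ) * (σ : ℂ)).im := im_two_mul_pos one_pos σ
  have e : theta 1 0 σ = jacobiTheta (2 * (1 : ℕ) * σ) := by
    rw [theta, thetaJ_eq one_pos, jacobiTheta_eq_jacobiTheta₂]
    simp
  have him' : (2 * (1 : ℕ) * (σ : ℂ)).im = 2 * σ.im := by simp
  have h1 := norm_jacobiTheta_sub_one_le him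
  rw [← e, him'] at h1
  set x := Real.exp (-π * (2 * σ.im)) with hx
  have hx0 : 0 < x := Real.exp_pos _
  -- `1/5` is the largest `x` for which the bound `2x/(1 - x)` on `|θ - 1|` is at most `1/2`.
  have hx1 : x ≤ 1 / 5 := by
    have h2 : (5 : ℝ) ≤ Real.exp (π * (2 * σ.im)) := by
      have := Real.add_one_le_exp (π * (2 * σ.im))
      nlinarith [Real.pi_gt_three]
    rw [hx, neg_mul, Real.exp_neg, one_div]
    exact inv_anti₀ (by norm_num) h2
  have h3 : 2 / (1 - x) * x ≤ 1 / 2 := by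
    rw [div_mul_eq_mul_div, div_le_iff₀ (by linarith)]
    linarith
  have h4 := norm_sub_norm_le (1 : ℂ) (1 - theta 1 0 σ)
  rw [norm_one, norm_sub_rev 1 (theta 1 0 σ), sub_sub_cancel] at h4
  linarith

lemma norm_exp_two_pi_I_mul (w : ℂ) : ‖cexp (2 * π * I * w)‖ = Real.exp (-(2 * π * w.im)) := by
  rw [Complex.norm_exp]
  congr 1
  rw [show 2 * π * I * w = ((2 * π : ℝ) : ℂ) * (I * w) by push_cast; ring, Complex.re_ofReal_mul,
    Complex.I_mul_re]
  ring

lemma im_upperTri {A B D : ℤ} (hA : 0 < A) (hD : 0 < D) (τ : ℍ) :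
    (upperTri A B D hA hD τ).im = A / D * τ.im := by
  change ((A * (τ : ℂ) + B) / D).im = _
  rw [show (D : ℂ) = ((D : ℝ) : ℂ) by push_cast; rfl, Complex.div_ofReal_im]
  simp
  ring

/-- At `r = A` the condition `n ≥ r²/4m` reads `n ≥ A/4D`, so the coefficient of `e(Az)` decays at
least like `exp(-2π (A/4D) Im τ)`. This is exactly the size of the factor `e(σ/4)` multiplying `F`,
since `Im σ = (A/D) Im τ`; the two cancel and leave `F` bounded. -/
lemma isBoundedAtImInfty_of_hasJacobiExpansion {m : ℕ} {A B D : ℤ} (hA : 0 < A) (hD : 0 < D)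
    (hAD : A * D = m) {F : ℍ → ℂ} {κ : ℂ} (hκ : κ ≠ 0)
    (h : HasJacobiExpansion m
      fun τ z => F τ * (κ * thetaDet 1 (upperTri A B D hA hD τ) (A * z))) :
    IsBoundedAtImInfty F := by
  obtain ⟨c, -, hc, hs⟩ := h
  have hAr : (0 : ℝ) < A := by exact_mod_cast hA
  have hDr : (0 : ℝ) < D := by exact_mod_cast hD
  set d : ℚ × ℤ → ℂ := fun p => if p.2 = A then c p.1 p.2 else 0 with hd
  have hdn : ∀ p, d p ≠ 0 → (A / (4 * D) : ℝ) ≤ (p.1 : ℝ) := by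
    intro p hp
    obtain ⟨h1, h2⟩ : p.2 = A ∧ c p.1 p.2 ≠ 0 := by
      simpa [hd] using hp
    have h3 := hc _ _ h2
    rw [h1] at h3
    have hm : (m : ℝ) = A * D := by exact_mod_cast hAD.symm
    have h4 : ((A : ℝ)) ^ 2 / (4 * m) ≤ (p.1 : ℝ) := by exact_mod_cast h3
    refine le_trans (le_of_eq ?_) h4
    rw [hm]
    field_simp
  have hsum : ∀ τ : ℍ, HasSum (fun p : ℚ × ℤ => d p * cexp (2 * π * I * (p.1 * τ)))
      (-(F τ * κ * theta 1 0 (upperTri A B D hA hD τ) *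
        cexp (2 * π * I * (upperTri A B D hA hD τ / 4)))) := by
    intro τ
    rw [← fourierInt_thetaDet hA]
    simp_rw [mul_assoc (F τ)]
    have := hasSum_fourierInt_trigSeries (C := fun p : ℚ × ℤ => c p.1 p.2 * cexp (2 * π * I * (p.1 * τ)))
      (R := fun p => p.2) (fun z => by
        convert hs τ z using 2 with p
        rw [mul_assoc, ← Complex.exp_add]
        congr 2; ring) A
    convert this using 2 with p
    simp only [hd]
    split_ifs <;> simp
  set K := ∑' p : ℚ × ℤ, ‖d p * cexp (2 * π * I * (p.1 * (UpperHalfPlane.I : ℍ)))‖ with hK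
  have hKs := (hsum UpperHalfPlane.I).summable.norm
  refine isBoundedAtImInfty_iff.mpr
    -- `Im τ ≥ 1` allows termwise comparison with the convergent series at `τ = i`, whose norm sum
    -- is `K`. `Im τ ≥ D` gives `Im σ ≥ 1`, hence the lower bound `1/2` on the theta constant, the
    -- source of the factor 2.
    ⟨2 * (K * Real.exp (2 * π * (A / (4 * D)))) / ‖κ‖, max 1 D, fun τ hτ => ?_⟩
  have hτ1 : 1 ≤ τ.im := (le_max_left _ _).trans hτ
  have hτD : (D : ℝ) ≤ τ.im := (le_max_right _ _).trans hτ
  have hσ : 1 ≤ (upperTri A B D hA hD τ).im := by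
    rw [im_upperTri, div_mul_eq_mul_div, le_div_iff₀ hDr, one_mul]
    have : (1 : ℝ) ≤ A := by exact_mod_cast hA
    nlinarith
  have hθ := half_le_norm_theta hσ
  have hterm : ∀ p : ℚ × ℤ, ‖d p * cexp (2 * π * I * (p.1 * τ))‖ ≤
      ‖d p * cexp (2 * π * I * (p.1 * (UpperHalfPlane.I : ℍ)))‖ *
        Real.exp (2 * π * (A / (4 * D)) * (1 - τ.im)) := by
    intro p
    by_cases hp : d p = 0
    · simp [hp]
    · have hq : ∀ τ : ℍ, ((p.1 : ℂ) * τ).im = p.1 * τ.im := fun τ => by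
        rw [← Complex.ofReal_ratCast, Complex.im_ofReal_mul]; rfl
      rw [norm_mul, norm_mul, norm_exp_two_pi_I_mul, norm_exp_two_pi_I_mul, hq, hq, mul_assoc ‖d p‖,
        ← Real.exp_add, UpperHalfPlane.I_im]
      refine mul_le_mul_of_nonneg_left (Real.exp_le_exp.mpr ?_) (norm_nonneg _)
      have h1 := mul_nonneg (mul_nonneg Real.two_pi_pos.le (sub_nonneg.mpr (hdn p hp)))
        (sub_nonneg.mpr hτ1)
      linarith
  have hbound : ‖F τ * κ * theta 1 0 (upperTri A B D hA hD τ) *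
      cexp (2 * π * I * (upperTri A B D hA hD τ / 4))‖ ≤
      K * Real.exp (2 * π * (A / (4 * D)) * (1 - τ.im)) := by
    rw [← norm_neg, ← (hsum τ).tsum_eq, hK, ← tsum_mul_right]
    refine (norm_tsum_le_tsum_norm (hsum τ).summable.norm).trans ?_
    exact (hsum τ).summable.norm.tsum_le_tsum hterm (hKs.mul_right _)
  have him4 : ((upperTri A B D hA hD τ : ℂ) / 4).im = A / (4 * D) * τ.im := by
    rw [show (4 : ℂ) = ((4 : ℝ) : ℂ) by push_cast; rfl, Complex.div_ofReal_im]
    change (upperTri A B D hA hD τ).im / 4 = _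
    rw [im_upperTri]
    ring
  rw [norm_mul, norm_exp_two_pi_I_mul, him4, norm_mul, norm_mul,
    show 2 * π * (A / (4 * D)) * (1 - τ.im) =
      2 * π * (A / (4 * D)) + -(2 * π * (A / (4 * D) * τ.im)) by ring, Real.exp_add,
    ← mul_assoc K] at hbound
  have hb := le_of_mul_le_mul_right hbound (Real.exp_pos _)
  rw [le_div_iff₀ (norm_pos_iff.mpr hκ)]
  have := mul_le_mul_of_nonneg_left hθ (mul_nonneg (norm_nonneg (F τ)) (norm_nonneg κ))
  linarith

lemma mem_modularForms_of_mulThetaDet_mem {k : ℤ} {m N : ℕ} (hm : 0 < m)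
    {χ : DirichletCharacter ℂ (m * N)} {f : ℍ → ℂ}
    (hf : mulThetaDet m f ∈ jacobiForms k m (m * N) χ) :
    f ∈ modularForms (k - 1) (m * N) (chiOmegaBar m N χ) := by
  obtain ⟨hol, hmod, -, hexp⟩ := hf
  refine ⟨?_, fun γ => ?_, fun g => ?_⟩
  · rw [UpperHalfPlane.mdifferentiable_iff]
    have hr : ∀ {ψ : ℍ → ℂ → ℂ}, IsHolomorphic ψ →
        DifferentiableOn ℂ (fun w => ψ (ofComplex w) (1 / (2 * m))) {z | 0 < z.im} := fun hψ =>
      DifferentiableOn.comp (t := {p : ℂ × ℂ | 0 < p.1.im}) hψ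
        (f := fun w : ℂ => (w, (1 / (2 * m) : ℂ))) (by fun_prop) fun p hp => hp
    -- `f` is recovered as a quotient at `z = 1/2m`, where the denominator never vanishes.
    refine ((hr hol).div (hr (isHolomorphic_thetaDet hm)) fun w _ =>
      thetaDet_div_two_ne_zero hm _).congr fun w _ => ?_
    rw [Function.comp_apply, Pi.div_apply, mulThetaDet_apply,
      mul_div_cancel_right₀ _ (thetaDet_div_two_ne_zero hm _)]
  · funext τ
    have h1 := congrFun (congrFun (hmod γ γ.2) τ) (1 / (2 * m))
    have h2 := jacobiSlash_mulThetaDet_of_mem_Gamma0 (k := k) hm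
      (Subgroup.inclusion (Gamma0_mul_le m N) γ) f τ (1 / (2 * m))
    have h3 := conj_omega_mul_self m (Subgroup.inclusion (Gamma0_mul_le m N) γ)
    simp only [Subgroup.coe_inclusion] at h2
    rw [h2] at h1
    simp only [Pi.smul_apply, smul_eq_mul, mulThetaDet_apply] at h1
    simp only [Pi.smul_apply, smul_eq_mul, chiOmegaBar]
    refine mul_right_cancel₀ (thetaDet_div_two_ne_zero hm τ) ?_
    linear_combination conj (omega m (Subgroup.inclusion (Gamma0_mul_le m N) γ)) * h1 -
      (f ∣[k - 1] (γ : SL(2, ℤ))) τ * thetaDet m τ (1 / (2 * m)) * h3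
  · obtain ⟨g', A, B, D, hA, hD, hAD, h00, h01, h10, h11⟩ := exists_upperTri_factorization hm g
    have hDc : (D : ℂ) ≠ 0 := by exact_mod_cast hD.ne'
    refine isBoundedAtImInfty_of_hasJacobiExpansion (B := B) hA hD hAD
      (div_ne_zero (det_weilMatrix_ne_zero g') hDc) ?_
    convert hexp g using 3 with τ z
    exact (jacobiSlash_mulThetaDet hm hA hD hAD h00 h01 h10 h11 f _ _).symm

/-- Vanishing at `z = 0` is one linear relation between the two remaining components, which makes
them proportional to `(θ_{m,m}, -θ_{m,0})`. -/
lemma exists_eq_mulThetaDet {k : ℤ} {m M : ℕ} (hm : 0 < m) {χ : DirichletCharacter ℂ M}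
    {φ : ℍ → ℂ → ℂ} (hφ : φ ∈ jacobiFormsStarKer k m M χ) : ∃ f, mulThetaDet m f = φ := by
  obtain ⟨⟨-, h, hdec, hvan⟩, hker⟩ := hφ
  have hsum : ∀ τ z, φ τ z = h 0 τ * thetaJ m 0 τ z + h m τ * thetaJ m m τ z := fun τ z => by
    rw [hdec.2, ← Finset.sum_subset (s₁ := {0, m})
      (fun r hr => by
        rcases Finset.mem_insert.mp hr with rfl | hr
        · exact Finset.mem_range.mpr (by omega)
        · rw [Finset.mem_singleton.mp hr]
          exact Finset.mem_range.mpr (by omega))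
      (fun r _ hr => by
        simp only [Finset.mem_insert, Finset.mem_singleton, not_or] at hr
        simp [hvan r hr.1 hr.2]),
      Finset.sum_pair hm.ne]
  refine ⟨fun τ => h 0 τ / theta m m τ, ?_⟩
  funext τ z
  have h0 : φ τ 0 = 0 := congrFun (LinearMap.mem_ker.mp hker) τ
  rw [hsum, ← theta, ← theta] at h0
  have hθ := theta_self_ne_zero hm τ
  rw [mulThetaDet_apply, hsum, thetaDet]
  field_simp
  linear_combination -thetaJ m m τ z * h0

lemma mulThetaDet_injective {m : ℕ} (hm : 0 < m) : Function.Injective (mulThetaDet m) := by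
  intro f g h
  funext τ
  have := congrFun (congrFun h τ) (1 / (2 * m))
  exact mul_right_cancel₀ (thetaDet_div_two_ne_zero hm τ) this

end JacobiTheta

/-! ### The isomorphism. -/

open JacobiTheta in
theorem theorem4p1 (k m N : ℕ) (hk : 0 < k) (hm : Squarefree m) (hN : 0 < N)
    (χ : DirichletCharacter ℂ (m * N)) :
    (∀ τ : ℍ, JacobiTheta.theta m 0 τ ≠ 0 ∧ JacobiTheta.theta m m τ ≠ 0) ∧
    (∀ φ ∈ JacobiTheta.jacobiForms k m (m * N) χ,
      ∃! h : ℕ → ℍ → ℂ, JacobiTheta.IsThetaDecomposition m φ h) ∧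
    ∃ Λ : JacobiTheta.jacobiFormsStarKer k m (m * N) χ ≃ₗ[ℂ]
        JacobiTheta.modularForms ((k : ℤ) - 1) (m * N) (JacobiTheta.chiOmegaBar m N χ),
      (∀ (φ : JacobiTheta.jacobiFormsStarKer k m (m * N) χ) (h : ℕ → ℍ → ℂ),
        JacobiTheta.IsThetaDecomposition m φ h → ∀ τ : ℍ,
          (Λ φ : ℍ → ℂ) τ = h 0 τ / JacobiTheta.theta m m τ ∧
          (Λ φ : ℍ → ℂ) τ = -h m τ / JacobiTheta.theta m 0 τ) ∧
      ∀ (f : JacobiTheta.modularForms ((k : ℤ) - 1) (m * N) (JacobiTheta.chiOmegaBar m N χ))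
        (τ : ℍ) (z : ℂ),
        (Λ.symm f : ℍ → ℂ → ℂ) τ z =
          (f : ℍ → ℂ) τ * (JacobiTheta.theta m m τ * JacobiTheta.thetaJ m 0 τ z -
            JacobiTheta.theta m 0 τ * JacobiTheta.thetaJ m m τ z) := by
  have hm0 : 0 < m := Nat.pos_of_ne_zero hm.ne_zero
  refine ⟨fun τ => ⟨theta_zero_ne_zero hm0 τ, theta_self_ne_zero hm0 τ⟩, fun φ hφ => ?_, ?_⟩
  · obtain ⟨h, hh⟩ := exists_thetaDecomposition hm0 hφ
    exact ⟨h, hh, fun h' hh' => hh'.unique hm0 hh⟩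
  -- The inverse map is built first, since it is plain multiplication by `thetaDet m`; its formula
  -- then holds by definition.
  let Ψ : modularForms ((k : ℤ) - 1) (m * N) (chiOmegaBar m N χ) →ₗ[ℂ]
      jacobiFormsStarKer k m (m * N) χ :=
    (mulThetaDet m).restrict fun f hf => mulThetaDet_mem hm0 hN hf
  have hΨ : Function.Bijective Ψ := by
    refine ⟨fun f g h => Subtype.ext (mulThetaDet_injective hm0 (congrArg Subtype.val h)),
      fun ⟨φ, hφ⟩ => ?_⟩
    obtain ⟨f, rfl⟩ := exists_eq_mulThetaDet hm0 hφ
    exact ⟨⟨f, mem_modularForms_of_mulThetaDet_mem hm0 hφ.1.1⟩, rfl⟩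
  refine ⟨(LinearEquiv.ofBijective Ψ hΨ).symm, fun φ h hh τ => ?_, fun f τ z => rfl⟩
  obtain ⟨f, rfl⟩ := (LinearEquiv.ofBijective Ψ hΨ).surjective φ
  rw [LinearEquiv.symm_apply_apply]
  -- Uniqueness replaces an arbitrary decomposition `h` by the explicit one of `f · thetaDet m`.
  have hd := hh.unique hm0 (mulThetaDet_isThetaDecomposition hm0 (f : ℍ → ℂ))
  rw [hd]
  simp only [if_true, if_neg hm0.ne', neg_neg]
  exact ⟨(mul_div_cancel_right₀ _ (theta_self_ne_zero hm0 τ)).symm,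
    (mul_div_cancel_right₀ _ (theta_zero_ne_zero hm0 τ)).symm⟩
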